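/- Let $k,m\ge 1$, $n=k+m$, and let $\rho$ be a probability density on $\mathbb{R}^n$ which is either (1) the density of the uniform distribution on a nonempty bounded convex open set $\mathcal X$, $\rho=\mathbf 1_{\mathcal X}/|\mathcal X|$, or (2) the density of the standard normal distribution $\mathcal N(0,I)$, with $\mathcal X=\mathbb{R}^n$. Orthogonal frames. For an orthogonal matrix $V=[V_1\;V_2]\in\mathbb{R}^{n\times n}$, with $V_1$ the first $k$ and $V_2$ the last $m$ columns, and for $y\in V_1^\top\mathcal X$, let $$\rho_V(z|y)=\frac{\rho(V_1y+V_2z)}{\int_{\mathbb{R}^m}\rho(V_1y+V_2z')\,dz'},\qquad z\in\mathbb{R}^m .$$ Let $C_{V,y}\in[0,\infty]$ be the Poincaré constant of $p=\rho_V(\cdot|y)$, i.e. the least $c\ge 0$ with $\int (u-\int u\,p)^2p\,dz\le c\int\|\nabla u\|^2p\,dz$ for all $u$ that are differentiable on $\{p>0\}$ with $u$ and $\nabla u$ square integrable with respect to $p$. Put $C=\sup_V\sup_{y\in V_1^\top\mathcal X}C_{V,y}$; it depends only on $\rho,k,m$. For a function $f$, put $g_V(y)=\int f(V_1y+V_2z)\,\rho_V(z|y)\,dz$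 and $f_{g_V}(x)=g_V(V_1^\top x)$. Then $0<C<\infty$, and the following holds. Let $f(x)=\frac12\|\Gamma^{-1/2}(d-\mathcal G(x))\|^2$ be the data misfit of a forward model $\mathcal G$ with values in $\mathbb{R}^q$, data $d\in\mathbb{R}^q$ and a symmetric positive definite noise covariance $\Gamma$. Assume that $f$ is differentiable on $\mathcal X$ and $\int\|\nabla f\|^2\rho\,dx<\infty$. Let $\int\nabla f\,\nabla f^\top\rho\,dx=W\,\mathrm{diag}(\lambda_1,\dots,\lambda_n)\,W^\top$ with $W$ orthogonal and $\lambda_1\ge\dots\ge\lambda_n$. Let $\hat W$ be an orthogonal matrix with $\|W-\hat W\|\le\varepsilon$ in the spectral norm, where $\varepsilon>0$, and let $f_{\hat g}=f_{g_{\hat W}}$. Put $$\rho_{\rm post}=\frac{e^{-f}\rho}{Z},\quad Z=\int e^{-f}\rho\,dx,\qquad \rho_{{\rm post},\hat g}=\frac{e^{-f_{\hat g}}\rho}{Z_{\hat g}},\quad Z_{\hat g}=\int e^{-f_{\hat g}}\rho\,dx,$$ and $d_{\rm H}(p,q)=\left(\frac12\int(\sqrt p-\sqrt q)^2dx\right)^{1/2}$.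 Then $\int f\rho\,dx<\infty$, and $$d_{\rm H}(\rho_{\rm post},\rho_{{\rm post},\hat g})\le\sqrt{C}\,L\left(\varepsilon(\lambda_1+\dots+\lambda_k)^{1/2}+(\lambda_{k+1}+\dots+\lambda_n)^{1/2}\right),$$ where $L>0$ is given by $L^2=\frac18\left(Z\exp\left(-\int f\rho\,dx\right)\right)^{-1/2}$. -/

import Mathlib

open MeasureTheory
open scoped ENNReal NNReal Gradient

noncomputable section

namespace ActiveSubspace

/-- `ℝⁿ` with the Euclidean norm and Lebesgue measure. -/
abbrev E (n : ℕ) : Type := EuclideanSpace ℝ (Fin n)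

/-! ### Prior densities -/

/-- The set of points at which the density `ρ` is positive. -/
def support {n : ℕ} (ρ : E n → ℝ) : Set (E n) := {x | 0 < ρ x}

/-- `ρ` is the density of the uniform distribution on a (nonempty) bounded convex open set. -/
def IsUniformConvex {n : ℕ} (ρ : E n → ℝ) : Prop :=
  ∃ X : Set (E n), IsOpen X ∧ Convex ℝ X ∧ Bornology.IsBounded X ∧ X.Nonempty ∧
    ρ = X.indicator (fun _ => (volume.real X)⁻¹)

/-- `ρ` is the density of the standard normal distribution `N(0, I)` on `ℝⁿ`. -/
def IsStdNormal {n : ℕ} (ρ : E n → ℝ) : Prop :=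
  ρ = fun x => (2 * Real.pi) ^ (-(n : ℝ) / 2) * Real.exp (-‖x‖ ^ 2 / 2)

/-! ### Active and inactive variables

A square matrix `W` with `k + m` columns is split as `W = [W₁ W₂]`, where `W₁` holds the first `k`
and `W₂` the last `m` columns. -/

/-- `W₁`, the first `k` columns. -/
def colsActive {k m : ℕ} (W : Matrix (Fin (k + m)) (Fin (k + m)) ℝ) :
    Matrix (Fin (k + m)) (Fin k) ℝ :=
  W.submatrix id (Fin.castAdd m)

/-- `W₂`, the last `m` columns. -/
def colsInactive {k m : ℕ} (W : Matrix (Fin (k + m)) (Fin (k + m)) ℝ) :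
    Matrix (Fin (k + m)) (Fin m) ℝ :=
  W.submatrix id (Fin.natAdd k)

/-- The point `x = W₁ y + W₂ z`. -/
def combine {k m : ℕ} (W : Matrix (Fin (k + m)) (Fin (k + m)) ℝ) (y : E k) (z : E m) :
    E (k + m) :=
  WithLp.toLp 2 ((colsActive W).mulVec y.ofLp + (colsInactive W).mulVec z.ofLp)

/-- The active variable `y = W₁ᵀ x`. -/
def activeVar {k m : ℕ} (W : Matrix (Fin (k + m)) (Fin (k + m)) ℝ) (x : E (k + m)) : E k :=
  WithLp.toLp 2 ((colsActive W).transpose.mulVec x.ofLp)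

/-- The domain `W₁ᵀ {ρ > 0}` of the active variable. -/
def activeDomain {k m : ℕ} (ρ : E (k + m) → ℝ) (W : Matrix (Fin (k + m)) (Fin (k + m)) ℝ) :
    Set (E k) :=
  activeVar W '' support ρ

/-- The marginal density `ρ_Y(y) = ∫ ρ(W₁ y + W₂ z) dz`. -/
def marginal {k m : ℕ} (ρ : E (k + m) → ℝ) (W : Matrix (Fin (k + m)) (Fin (k + m)) ℝ)
    (y : E k) : ℝ :=
  ∫ z : E m, ρ (combine W y z)

/-- The conditional density `ρ_{Z|Y}(z|y) = ρ(W₁ y + W₂ z) / ρ_Y(y)`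
(zero where `ρ_Y(y) = 0`). -/
def condDensity {k m : ℕ} (ρ : E (k + m) → ℝ) (W : Matrix (Fin (k + m)) (Fin (k + m)) ℝ)
    (y : E k) (z : E m) : ℝ :=
  ρ (combine W y z) / marginal ρ W y

/-- The function `g(y) = ∫ f(W₁ y + W₂ z) ρ_{Z|Y}(z|y) dz`. -/
def condMean {k m : ℕ} (ρ f : E (k + m) → ℝ) (W : Matrix (Fin (k + m)) (Fin (k + m)) ℝ)
    (y : E k) : ℝ :=
  ∫ z : E m, f (combine W y z) * condDensity ρ W y z

/-- The approximation `f_g(x) = g(W₁ᵀ x)` of `f`. -/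
def ridgeApprox {k m : ℕ} (ρ f : E (k + m) → ℝ) (W : Matrix (Fin (k + m)) (Fin (k + m)) ℝ)
    (x : E (k + m)) : ℝ :=
  condMean ρ f W (activeVar W x)

/-- The averaged outer product `∫ ∇f(x) ∇f(x)ᵀ ρ(x) dx` of the gradient with itself. -/
def gradOuter {n : ℕ} (ρ f : E n → ℝ) : Matrix (Fin n) (Fin n) ℝ :=
  Matrix.of fun i j => ∫ x : E n, (∇ f x) i * (∇ f x) j * ρ x

/-! ### Poincaré constants -/

/-- `c` is admissible in the Poincaré inequality for the probability density `p` on `ℝᵐ`: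
`Var_p(u) ≤ c ∫ ‖∇u‖² p` for every `u` that is differentiable on `{p > 0}` and, together with its
gradient, square integrable with respect to `p`. -/
def PoincareIneq {m : ℕ} (p : E m → ℝ) (c : ℝ≥0) : Prop :=
  ∀ u : E m → ℝ, DifferentiableOn ℝ u (support p) →
    MemLp u 2 (volume.withDensity fun z => ENNReal.ofReal (p z)) →
    MemLp (fun z => ∇ u z) 2 (volume.withDensity fun z => ENNReal.ofReal (p z)) →
    ∫ z : E m, (u z - ∫ z' : E m, u z' * p z') ^ 2 * p z ≤
      (c : ℝ) * ∫ z : E m, ‖∇ u z‖ ^ 2 * p z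

/-- The Poincaré constant of `p`: the least admissible constant, `∞` if there is none. -/
def poincareConst {m : ℕ} (p : E m → ℝ) : ℝ≥0∞ :=
  ⨅ (c : ℝ≥0) (_ : PoincareIneq p c), (c : ℝ≥0∞)

/-- The supremum of the Poincaré constants of the conditional densities `ρ_{Z|Y}(·|y)`, over all
orthogonal matrices `V = [V₁ V₂]` with `V₁` of `k` and `V₂` of `m` columns and all `y` in the
domain `V₁ᵀ {ρ > 0}` of the active variable. It depends only on `ρ`, `k` and `m`. -/
def condPoincareConst {k m : ℕ} (ρ : E (k + m) → ℝ) : ℝ≥0∞ :=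
  ⨆ V ∈ Matrix.orthogonalGroup (Fin (k + m)) ℝ, ⨆ y ∈ activeDomain ρ V,
    poincareConst (condDensity ρ V y)

/-! ### Bayesian inversion -/

/-- The data misfit `x ↦ ½ ‖Γ^{-1/2} (d - G(x))‖² = ½ (d - G(x))ᵀ Γ⁻¹ (d - G(x))`. -/
def dataMisfit {n q : ℕ} (Γ : Matrix (Fin q) (Fin q) ℝ) (d : E q) (G : E n → E q) (x : E n) : ℝ :=
  1 / 2 * ((d - G x).ofLp ⬝ᵥ Γ⁻¹.mulVec (d - G x).ofLp)

/-- The normalizing constant `∫ exp(-h(x)) ρ(x) dx`. -/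
def evidence {n : ℕ} (ρ h : E n → ℝ) : ℝ :=
  ∫ x : E n, Real.exp (-h x) * ρ x

/-- The posterior density for the prior density `ρ` and the negative log-likelihood `h`. -/
def posterior {n : ℕ} (ρ h : E n → ℝ) (x : E n) : ℝ :=
  Real.exp (-h x) * ρ x / evidence ρ h

/-- The Hellinger distance `(½ ∫ (√p - √q)²)^{1/2}` of two probability densities. -/
def hellinger {n : ℕ} (p q : E n → ℝ) : ℝ :=
  Real.sqrt (1 / 2 * ∫ x : E n, (Real.sqrt (p x) - Real.sqrt (q x)) ^ 2)

/-- `L = (⅛ (Z exp(-∫ f ρ))^{-1/2})^{1/2}`. -/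
def constL {n : ℕ} (ρ f : E n → ℝ) : ℝ :=
  Real.sqrt (1 / 8 * (evidence ρ f * Real.exp (-∫ x : E n, f x * ρ x)) ^ (-(1 / 2) : ℝ))

end ActiveSubspace

end

noncomputable section

namespace ActiveSubspace

/-! ### Measures with a density -/

/-! The bound is a product of two estimates, joined by the error of `f_g` in `L²(ρ)`.

Hellinger distance (`hellinger_posterior_le`). Of the data misfit only `f ≥ 0` matters, since `t ↦
exp(-t/2)` is 1/2-Lipschitz on `[0, ∞)`. With `a = √Z`, `b = √Z_g` and `I = ∫ exp(-(f + f_g)/2) ρ`,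
the squared distance is `1 - I/(ab) ≤ (a² + b² - 2I)/(2ab) ≤ ‖f - f_g‖²/(8ab)`. Conditional
averaging preserves the mean, so Jensen gives `Z_g ≥ exp(-∫ f ρ)`; this bounds `ab` from below and
produces `L`.

Approximation error (`lintegral_ridgeApprox_error_le`, `lintegral_inactiveVar_perturb_le`). On each
fiber `y = const`, `f_g` is the mean of `f` and the gradient of the restricted `f` is `V₂ᵀ∇f`. The
Poincaré inequality on fibers and Fubini give `‖f - f_g‖² ≤ C ∫ ‖V₂ᵀ∇f‖² ρ`. Since `V₂ᵀV₁ = 0`,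
replacing `W` by `V` sends at most `ε‖W₁ᵀ∇f‖` into the inactive part, and the triangle inequality in
`L²(ρ)` yields the two eigenvalue sums.

Finiteness of `C` rests on the class of priors being closed under conditioning: the conditionals are
uniform on convex slices of no larger diameter, or standard normal. Both cases satisfy a bound of
`∫∫ |u(x) - u(y)|²` by the gradient energy, with a constant depending only on diameter and
dimension. This form does not presuppose `u ∈ L²`; it therefore also shows that `∇f ∈ L²` forces `f
∈ L²`, on the whole space and on fibers. -/

/-- The measure with density `p` with respect to Lebesgue measure. -/
def dens {n : ℕ} (p : E n → ℝ) : Measure (E n) :=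
  volume.withDensity fun z => ENNReal.ofReal (p z)

section Dens

variable {n : ℕ} {p : E n → ℝ}

lemma lintegral_dens (hp : Measurable p) (g : E n → ℝ≥0∞) :
    ∫⁻ x, g x ∂dens p = ∫⁻ x, ENNReal.ofReal (p x) * g x := by
  unfold dens
  rw [lintegral_withDensity_eq_lintegral_mul_non_measurable _ hp.ennreal_ofReal
    (ae_of_all _ fun _ => ENNReal.ofReal_lt_top)]
  rfl

lemma integral_dens (hp : Measurable p) (h0 : ∀ x, 0 ≤ p x) (g : E n → ℝ) :
    ∫ x, g x ∂dens p = ∫ x, g x * p x := by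
  unfold dens
  rw [integral_withDensity_eq_integral_toReal_smul hp.ennreal_ofReal
    (ae_of_all _ fun _ => ENNReal.ofReal_lt_top)]
  simp only [ENNReal.toReal_ofReal (h0 _), smul_eq_mul, mul_comm]

lemma integrable_dens (hp : Measurable p) (h0 : ∀ x, 0 ≤ p x) (g : E n → ℝ) :
    Integrable g (dens p) ↔ Integrable fun x => g x * p x := by
  unfold dens
  rw [integrable_withDensity_iff_integrable_smul' hp.ennreal_ofReal
    (ae_of_all _ fun _ => ENNReal.ofReal_lt_top)]
  simp only [ENNReal.toReal_ofReal (h0 _), smul_eq_mul, mul_comm]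

lemma ae_dens (hp : Measurable p) : ∀ᵐ x ∂dens p, x ∈ support p := by
  unfold dens
  rw [ae_withDensity_iff hp.ennreal_ofReal]
  refine ae_of_all _ fun x hx => ?_
  by_contra h
  exact hx (ENNReal.ofReal_eq_zero.2 (not_lt.1 h))

/-- `u` is arbitrary off the support, but that set is null for `dens p`. -/
lemma aestronglyMeasurable_dens (hp : Measurable p) (hs : IsOpen (support p)) {u : E n → ℝ}
    (hu : ContinuousOn u (support p)) : AEStronglyMeasurable u (dens p) := by
  have h := hu.aestronglyMeasurable (μ := dens p) hs.measurableSet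
  rwa [Measure.restrict_eq_self_of_ae_mem (ae_dens hp)] at h

lemma measurable_gradient (u : E n → ℝ) : Measurable (∇ u) :=
  (InnerProductSpace.toDual ℝ (E n)).symm.continuous.measurable.comp (measurable_fderiv ℝ u)

lemma norm_gradient (u : E n → ℝ) (x : E n) : ‖∇ u x‖ = ‖fderiv ℝ u x‖ := by
  rw [← toDual_gradient, LinearIsometryEquiv.norm_map]

lemma enorm_gradient (u : E n → ℝ) (x : E n) : ‖∇ u x‖ₑ = ‖fderiv ℝ u x‖ₑ := by
  rw [← ofReal_norm, ← ofReal_norm, norm_gradient]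

/-- The density of a uniform distribution on a bounded convex open set or of `N(0, I)`. -/
def IsPrior (p : E n → ℝ) : Prop := IsUniformConvex p ∨ IsStdNormal p

lemma integral_exp_neg_half_sq (n : ℕ) :
    ∫ x : E n, Real.exp (-‖x‖ ^ 2 / 2) = (2 * Real.pi) ^ ((n : ℝ) / 2) := by
  have h := GaussianFourier.integral_rexp_neg_mul_sq_norm (V := E n)
    (b := 1 / 2) (by norm_num)
  simp only [finrank_euclideanSpace, Fintype.card_fin] at h
  rw [show Real.pi / (1 / 2) = 2 * Real.pi by ring] at h
  rw [← h]
  congr 1; ext x; congr 1; ring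

lemma integral_stdNormal (n : ℕ) :
    ∫ x : E n, (2 * Real.pi) ^ (-(n : ℝ) / 2) * Real.exp (-‖x‖ ^ 2 / 2) = 1 := by
  rw [integral_const_mul, integral_exp_neg_half_sq, ← Real.rpow_add (by positivity)]
  simp [neg_div]

lemma IsPrior.measurable (hp : IsPrior p) : Measurable p := by
  rcases hp with ⟨X, hX, -, -, -, rfl⟩ | rfl
  · exact measurable_const.indicator hX.measurableSet
  · fun_prop

lemma volume_real_pos {X : Set (E n)} (hX : IsOpen X) (hb : Bornology.IsBounded X)
    (hne : X.Nonempty) : 0 < volume.real X :=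
  ENNReal.toReal_pos (hX.measure_pos _ hne).ne' hb.measure_lt_top.ne

lemma IsPrior.nonneg (hp : IsPrior p) (x : E n) : 0 ≤ p x := by
  rcases hp with ⟨X, hX, -, -, -, rfl⟩ | rfl
  · exact Set.indicator_nonneg (fun _ _ => by positivity) _
  · positivity

lemma support_indicator {X : Set (E n)} {c : ℝ} (hc : 0 < c) :
    support (X.indicator fun _ => c) = X := by
  ext x
  by_cases hx : x ∈ X <;> simp [support, hx, hc]

lemma IsStdNormal.support_eq (hp : IsStdNormal p) : support p = Set.univ := by
  subst hp
  ext x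
  simp only [support, Set.mem_ofPred_eq, Set.mem_univ, iff_true]
  positivity

lemma IsPrior.isOpen_support (hp : IsPrior p) : IsOpen (support p) := by
  rcases hp with ⟨X, hX, -, hb, hne, rfl⟩ | hp
  · rwa [support_indicator (inv_pos.2 (volume_real_pos hX hb hne))]
  · simp [hp.support_eq]

lemma IsPrior.nonempty_support (hp : IsPrior p) : (support p).Nonempty := by
  rcases hp with ⟨X, hX, -, hb, hne, rfl⟩ | hp
  · rwa [support_indicator (inv_pos.2 (volume_real_pos hX hb hne))]
  · simp [hp.support_eq]

lemma IsPrior.integral_eq_one (hp : IsPrior p) : ∫ x, p x = 1 := by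
  rcases hp with ⟨X, hX, -, hb, hne, rfl⟩ | rfl
  · rw [integral_indicator hX.measurableSet, setIntegral_const, smul_eq_mul,
      mul_inv_cancel₀ (volume_real_pos hX hb hne).ne']
  · exact integral_stdNormal n

lemma IsPrior.integrable (hp : IsPrior p) : Integrable p := by
  -- A nonintegrable function has integral zero by convention, whereas this integral is one.
  by_contra h
  simpa [integral_undef h] using hp.integral_eq_one

lemma IsPrior.isProbabilityMeasure (hp : IsPrior p) : IsProbabilityMeasure (dens p) := by
  constructor
  unfold dens
  rw [withDensity_apply _ MeasurableSet.univ, Measure.restrict_univ,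
    ← ofReal_integral_eq_lintegral_ofReal hp.integrable (ae_of_all _ hp.nonneg),
    hp.integral_eq_one, ENNReal.ofReal_one]

lemma dens_uniform {X : Set (E n)} (hX : IsOpen X) (hb : Bornology.IsBounded X)
    (hne : X.Nonempty) :
    dens (X.indicator fun _ => (volume.real X)⁻¹) = (volume X)⁻¹ • volume.restrict X := by
  have h : (fun z => ENNReal.ofReal (X.indicator (fun _ => (volume.real X)⁻¹) z)) =
      X.indicator fun _ => (volume X)⁻¹ := by
    ext z
    by_cases hz : z ∈ X
    · simp only [Set.indicator_of_mem hz]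
      rw [ENNReal.ofReal_inv_of_pos (volume_real_pos hX hb hne), Measure.real,
        ENNReal.ofReal_toReal hb.measure_lt_top.ne]
    · simp [hz]
  unfold dens
  rw [h, withDensity_indicator hX.measurableSet, withDensity_const]

end Dens

/-! ### Poincaré inequalities in double integral form -/

lemma sq_lintegral_le {α : Type*} [MeasurableSpace α] (μ : Measure α) {φ : α → ℝ≥0∞}
    (hφ : AEMeasurable φ μ) : (∫⁻ t, φ t ∂μ) ^ 2 ≤ μ Set.univ * ∫⁻ t, φ t ^ 2 ∂μ := by
  have h := ENNReal.lintegral_mul_le_Lp_mul_Lq μ Real.HolderConjugate.two_two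
    (aemeasurable_const (b := (1 : ℝ≥0∞))) hφ
  simp only [Pi.mul_apply, one_mul, lintegral_const, ENNReal.rpow_two, one_pow] at h
  calc (∫⁻ t, φ t ∂μ) ^ 2
      ≤ ((μ Set.univ) ^ (1 / 2 : ℝ) * (∫⁻ t, φ t ^ 2 ∂μ) ^ (1 / 2 : ℝ)) ^ 2 := by gcongr
    _ = _ := by
        rw [mul_pow, ← ENNReal.rpow_two, ← ENNReal.rpow_two, ← ENNReal.rpow_mul,
          ← ENNReal.rpow_mul]
        norm_num

/-- Fundamental theorem of calculus and Cauchy–Schwarz. In `ℝ≥0∞` no integrability of the derivative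
is needed: if it fails, the right-hand integral is infinite. -/
lemma enorm_sub_sq_le_lintegral_deriv {v : ℝ → ℝ} {a b : ℝ} (hab : a ≤ b)
    (hv : ∀ t ∈ Set.Icc a b, DifferentiableAt ℝ v t) :
    ‖v b - v a‖ₑ ^ 2 ≤ ENNReal.ofReal (b - a) * ∫⁻ t in Set.Ioc a b, ‖deriv v t‖ₑ ^ 2 := by
  have hm : Measurable (deriv v) := measurable_deriv v
  have hcs := sq_lintegral_le (volume.restrict (Set.Ioc a b)) hm.enorm.aemeasurable
  simp only [Measure.restrict_apply MeasurableSet.univ, Set.univ_inter, Real.volume_Ioc] at hcs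
  refine le_trans ?_ hcs
  gcongr
  by_cases hfin : ∫⁻ t in Set.Ioc a b, ‖deriv v t‖ₑ = ⊤
  · rw [hfin]; exact le_top
  have hint : IntervalIntegrable (deriv v) volume a b := by
    rw [intervalIntegrable_iff_integrableOn_Ioc_of_le hab]
    exact ⟨hm.aestronglyMeasurable, lt_top_iff_ne_top.2 hfin⟩
  rw [← intervalIntegral.integral_eq_sub_of_hasDerivAt
    (fun t ht => (hv t (by rwa [Set.uIcc_of_le hab] at ht)).hasDerivAt) hint,
    intervalIntegral.integral_of_le hab]
  exact enorm_integral_le_lintegral_enorm _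

/-! ### Bounded convex sets: averaging over segments. -/

lemma lintegral_comp_const_add_smul {n : ℕ} (φ : E n → ℝ≥0∞) (hφ : Measurable φ) (a : E n) {t : ℝ}
    (ht : t ≠ 0) :
    ∫⁻ x, φ (a + t • x) = ENNReal.ofReal |(t ^ n)⁻¹| * ∫⁻ x, φ x := by
  have h := Measure.map_addHaar_smul (volume : Measure (E n)) ht
  rw [finrank_euclideanSpace, Fintype.card_fin] at h
  rw [← lintegral_map (f := fun x => φ (a + x)) (g := fun x => t • x) (by fun_prop) (by fun_prop),
    h, lintegral_smul_measure, lintegral_add_left_eq_self φ a, smul_eq_mul]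

/-- The point is `t x + (1 - t) y`, and one of the two coefficients is at least 1/2. Substituting in
that variable costs a Jacobian of at most `2 ^ n`, with no singularity at `t = 0` or `t = 1`; the
other variable contributes `volume X`. -/
lemma lintegral_comp_segment_le {n : ℕ} {X : Set (E n)} (φ : E n → ℝ≥0∞)
    (hφ : Measurable φ) (t : ℝ) :
    ∫⁻ x in X, ∫⁻ y in X, φ (y + t • (x - y)) ≤ 2 ^ n * volume X * ∫⁻ x, φ x := by
  have key : ∀ s : ℝ, 1 / 2 ≤ s → ∀ a : E n, ∫⁻ x in X, φ (a + s • x) ≤ 2 ^ n * ∫⁻ x, φ x := by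
    intro s hs a
    refine (setLIntegral_le_lintegral _ _).trans ?_
    rw [lintegral_comp_const_add_smul φ hφ a (by positivity)]
    gcongr
    rw [abs_of_nonneg (by positivity), ← inv_pow]
    have h2 : s⁻¹ ≤ 2 := by
      rw [inv_le_comm₀ (by linarith) (by norm_num)]; linarith
    calc ENNReal.ofReal (s⁻¹ ^ n) ≤ ENNReal.ofReal (2 ^ n) := by
          gcongr
      _ = 2 ^ n := by rw [ENNReal.ofReal_pow (by norm_num)]; norm_num
  rcases le_total (1 / 2) t with h | h
  · rw [lintegral_lintegral_swap (by fun_prop)]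
    calc ∫⁻ y in X, ∫⁻ x in X, φ (y + t • (x - y))
        ≤ ∫⁻ _ in X, 2 ^ n * ∫⁻ x, φ x := by
          refine lintegral_mono fun y => ?_
          convert key t h ((1 - t) • y) using 4
          module
      _ = _ := by rw [setLIntegral_const]; ring
  · calc ∫⁻ x in X, ∫⁻ y in X, φ (y + t • (x - y))
        ≤ ∫⁻ _ in X, 2 ^ n * ∫⁻ x, φ x := by
          refine lintegral_mono fun x => ?_
          convert key (1 - t) (by linarith) (t • x) using 4
          module
      _ = _ := by rw [setLIntegral_const]; ring

/-- By convexity the segment from `y` to `x` stays in `X`, so `u x - u y` is an integral of `∇u`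
along it, with speed at most `D`. Exchanging the integrals leaves, for each `t`, the previous lemma.
-/
lemma double_poincare_convex {n : ℕ} {X : Set (E n)} (hX : IsOpen X) (hc : Convex ℝ X) {D : ℝ≥0}
    (hD : ∀ x ∈ X, ∀ y ∈ X, ‖x - y‖ₑ ≤ D) {u : E n → ℝ} (hu : DifferentiableOn ℝ u X) :
    ∫⁻ x in X, ∫⁻ y in X, ‖u x - u y‖ₑ ^ 2 ≤
      D ^ 2 * 2 ^ n * volume X * ∫⁻ x in X, ‖∇ u x‖ₑ ^ 2 := by
  set φ : E n → ℝ≥0∞ := X.indicator fun x => ‖∇ u x‖ₑ ^ 2 with hφdef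
  have hφ : Measurable φ := ((measurable_gradient u).enorm.pow_const 2).indicator hX.measurableSet
  have hpt : ∀ x ∈ X, ∀ y ∈ X, ‖u x - u y‖ₑ ^ 2 ≤
      D ^ 2 * ∫⁻ t in Set.Ioc (0 : ℝ) 1, φ (y + t • (x - y)) := by
    intro x hx y hy
    have hmem : ∀ t ∈ Set.Icc (0 : ℝ) 1, y + t • (x - y) ∈ X := fun t ht =>
      hc.add_smul_sub_mem hy hx ht
    have hder : ∀ t ∈ Set.Icc (0 : ℝ) 1, HasDerivAt (fun t : ℝ => u (y + t • (x - y)))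
        (fderiv ℝ u (y + t • (x - y)) (x - y)) t := by
      intro t ht
      have h1 := (hu.differentiableAt (hX.mem_nhds (hmem t ht))).hasFDerivAt
      have h2 : HasDerivAt (fun t : ℝ => y + t • (x - y)) (x - y) t := by
        simpa using ((hasDerivAt_id t).smul_const (x - y)).const_add y
      exact h1.comp_hasDerivAt t h2
    have h := enorm_sub_sq_le_lintegral_deriv (v := fun t : ℝ => u (y + t • (x - y)))
      zero_le_one fun t ht => (hder t ht).differentiableAt
    simp only [one_smul, add_sub_cancel, zero_smul, add_zero, sub_zero, ENNReal.ofReal_one,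
      one_mul] at h
    refine h.trans ?_
    rw [← lintegral_const_mul _ (by fun_prop)]
    refine setLIntegral_mono' measurableSet_Ioc fun t ht => ?_
    have ht' : t ∈ Set.Icc (0 : ℝ) 1 := ⟨ht.1.le, ht.2⟩
    rw [(hder t ht').deriv, hφdef, Set.indicator_of_mem (hmem t ht'), enorm_gradient, ← mul_pow,
      mul_comm]
    gcongr
    exact (ContinuousLinearMap.le_opENorm _ _).trans (by gcongr; exact hD x hx y hy)
  calc ∫⁻ x in X, ∫⁻ y in X, ‖u x - u y‖ₑ ^ 2
      ≤ ∫⁻ x in X, ∫⁻ y in X, D ^ 2 * ∫⁻ t in Set.Ioc (0 : ℝ) 1, φ (y + t • (x - y)) :=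
        setLIntegral_mono' hX.measurableSet fun x hx =>
          setLIntegral_mono' hX.measurableSet fun y hy => hpt x hx y hy
    _ = D ^ 2 * ∫⁻ x in X, ∫⁻ y in X, ∫⁻ t in Set.Ioc (0 : ℝ) 1, φ (y + t • (x - y)) := by
        have hm2 : ∀ x, Measurable fun y => ∫⁻ t in Set.Ioc (0 : ℝ) 1, φ (y + t • (x - y)) :=
          fun x => Measurable.lintegral_prod_right' (f := fun q : E n × ℝ =>
            φ (q.1 + q.2 • (x - q.1))) (by fun_prop)
        have hm3 : Measurable fun x => ∫⁻ y in X, ∫⁻ t in Set.Ioc (0 : ℝ) 1, φ (y + t • (x - y)) :=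
          Measurable.lintegral_prod_right' (f := fun q : E n × E n =>
            ∫⁻ t in Set.Ioc (0 : ℝ) 1, φ (q.2 + t • (q.1 - q.2)))
            (Measurable.lintegral_prod_right' (f := fun r : (E n × E n) × ℝ =>
              φ (r.1.2 + r.2 • (r.1.1 - r.1.2))) (by fun_prop))
        rw [← lintegral_const_mul _ hm3]
        refine lintegral_congr fun x => ?_
        rw [lintegral_const_mul _ (hm2 x)]
    _ = D ^ 2 * ∫⁻ t in Set.Ioc (0 : ℝ) 1, ∫⁻ x in X, ∫⁻ y in X, φ (y + t • (x - y)) := by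
        congr 1
        have hm : Measurable fun r : ℝ × E n => ∫⁻ y in X, φ (y + r.1 • (r.2 - y)) :=
          Measurable.lintegral_prod_right' (f := fun r : (ℝ × E n) × E n =>
              φ (r.2 + r.1.1 • (r.1.2 - r.2))) (by fun_prop)
        symm
        rw [lintegral_lintegral_swap hm.aemeasurable]
        refine lintegral_congr fun x => ?_
        rw [lintegral_lintegral_swap (by fun_prop)]
    _ ≤ D ^ 2 * ∫⁻ _ in Set.Ioc (0 : ℝ) 1, 2 ^ n * volume X * ∫⁻ x, φ x := by
        refine mul_le_mul' le_rfl (lintegral_mono fun t => ?_)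
        exact lintegral_comp_segment_le φ hφ t
    _ = D ^ 2 * 2 ^ n * volume X * ∫⁻ x in X, ‖∇ u x‖ₑ ^ 2 := by
        rw [setLIntegral_const, hφdef, lintegral_indicator hX.measurableSet]
        simp [mul_assoc]

/-! ### The Gaussian measure: averaging over rotations. -/

/-- The rotation `(x, y) ↦ (s x + c y, c x - s y)`. -/
def rot {n : ℕ} (s c : ℝ) (q : E n × E n) : E n × E n :=
  (s • q.1 + c • q.2, c • q.1 - s • q.2)

lemma norm_sq_rot {n : ℕ} {s c : ℝ} (h : s ^ 2 + c ^ 2 = 1) (q : E n × E n) :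
    ‖(rot s c q).1‖ ^ 2 + ‖(rot s c q).2‖ ^ 2 = ‖q.1‖ ^ 2 + ‖q.2‖ ^ 2 := by
  simp only [rot, norm_add_sq_real, norm_sub_sq_real, norm_smul, mul_pow, inner_smul_left,
    inner_smul_right, Real.norm_eq_abs, sq_abs, RCLike.conj_to_real]
  linear_combination (‖q.1‖ ^ 2 + ‖q.2‖ ^ 2) * h

lemma measurePreserving_rot {n : ℕ} {s c : ℝ} (h : s ^ 2 + c ^ 2 = 1) :
    MeasurePreserving (rot (n := n) s c) := by
  -- The plain product carries the sup norm, for which a rotation is no isometry; volume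
  -- preservation is read off in the `ℓ²` product.
  let L : WithLp 2 (E n × E n) →ₗᵢ[ℝ] WithLp 2 (E n × E n) :=
    { toFun := fun q => WithLp.toLp 2 (rot s c q.ofLp)
      map_add' := fun p q => by
        refine WithLp.ofLp_injective 2 (Prod.ext ?_ ?_) <;> simp [rot] <;> module
      map_smul' := fun a q => by
        refine WithLp.ofLp_injective 2 (Prod.ext ?_ ?_) <;> simp [rot] <;> module
      norm_map' := fun q => by
        rw [← sq_eq_sq₀ (norm_nonneg _) (norm_nonneg _)]
        simpa [WithLp.prod_norm_sq_eq_of_L2] using norm_sq_rot h q.ofLp }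
  have h1 := (L.toLinearIsometryEquiv rfl).measurePreserving
  exact ((WithLp.volume_preserving_ofLp (E n) (E n)).comp h1).comp
    (WithLp.volume_preserving_toLp (E n) (E n))

lemma lintegral_gaussian_rot {n : ℕ} {p : E n → ℝ} (hp : IsStdNormal p) {s c : ℝ}
    (h : s ^ 2 + c ^ 2 = 1) {F : E n × E n → ℝ≥0∞} (hF : Measurable F) :
    ∫⁻ q, F (rot s c q) ∂((dens p).prod (dens p)) = ∫⁻ q, F q ∂((dens p).prod (dens p)) := by
  have hm : Measurable p := IsPrior.measurable (Or.inr hp)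
  have hw : Measurable fun q : E n × E n => ENNReal.ofReal (p q.1) * ENNReal.ofReal (p q.2) := by
    fun_prop
  have hR := measurePreserving_rot (n := n) h
  have inv : ∀ q : E n × E n, ENNReal.ofReal (p (rot s c q).1) * ENNReal.ofReal (p (rot s c q).2)
      = ENNReal.ofReal (p q.1) * ENNReal.ofReal (p q.2) := by
    intro q
    rw [← ENNReal.ofReal_mul (IsPrior.nonneg (Or.inr hp) _),
      ← ENNReal.ofReal_mul (IsPrior.nonneg (Or.inr hp) _)]
    subst hp
    simp only
    rw [mul_mul_mul_comm, mul_mul_mul_comm (_ ^ _) (Real.exp _), ← Real.exp_add, ← Real.exp_add]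
    congr 3
    linear_combination (-1 / 2) * norm_sq_rot h q
  unfold dens
  rw [prod_withDensity (by fun_prop) (by fun_prop),
    lintegral_withDensity_eq_lintegral_mul (g := fun q => F (rot s c q)) _ hw
      (hF.comp hR.measurable),
    lintegral_withDensity_eq_lintegral_mul _ hw hF]
  rw [← Measure.volume_eq_prod, ← hR.lintegral_comp (hw.mul hF)]
  refine lintegral_congr fun q => ?_
  simp only [Pi.mul_apply, inv]

/-- From `r²/4 ≤ exp(r²/4)` one gets `r² exp(-r²/2) ≤ 4 exp(-r²/4)`, again a Gaussian. -/
lemma lintegral_sq_norm_stdNormal_lt_top {n : ℕ} {p : E n → ℝ} (hp : IsStdNormal p) :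
    ∫⁻ x, ‖x‖ₑ ^ 2 ∂dens p < ⊤ := by
  have hm : Measurable p := IsPrior.measurable (Or.inr hp)
  have hint : Integrable fun x : E n => Real.exp (-(1 / 4) * ‖x‖ ^ 2) := by
    by_contra h
    have h2 := GaussianFourier.integral_rexp_neg_mul_sq_norm (V := E n)
      (b := 1 / 4) (by norm_num)
    rw [integral_undef h] at h2
    exact (Real.rpow_pos_of_pos (by positivity) _).ne h2
  have hint2 := (hint.const_mul (4 * (2 * Real.pi) ^ (-(n : ℝ) / 2))).lintegral_lt_top
  rw [lintegral_dens hm]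
  refine lt_of_le_of_lt (lintegral_mono fun x => ?_) hint2
  rw [← ofReal_norm, ← ENNReal.ofReal_pow (norm_nonneg _),
    ← ENNReal.ofReal_mul (IsPrior.nonneg (Or.inr hp) _)]
  refine ENNReal.ofReal_le_ofReal ?_
  subst hp
  have h1 : ‖x‖ ^ 2 / 4 ≤ Real.exp (‖x‖ ^ 2 / 4) := by
    linarith [Real.add_one_le_exp (‖x‖ ^ 2 / 4)]
  have h2 : Real.exp (-(1 / 4) * ‖x‖ ^ 2) = Real.exp (-‖x‖ ^ 2 / 2) * Real.exp (‖x‖ ^ 2 / 4) := by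
    rw [← Real.exp_add]; congr 1; ring
  rw [h2]
  calc (2 * Real.pi) ^ (-(n : ℝ) / 2) * Real.exp (-‖x‖ ^ 2 / 2) * ‖x‖ ^ 2
      = 4 * (2 * Real.pi) ^ (-(n : ℝ) / 2) * (Real.exp (-‖x‖ ^ 2 / 2) * (‖x‖ ^ 2 / 4)) := by ring
    _ ≤ _ := by gcongr

/-- The Maurey–Pisier argument: the arc `sin t x + cos t y` runs from `y` to `x`, and its velocity
`cos t x - sin t y` is independent of its position, the pair being a rotation of `(x, y)`. Hence the
integral at each `t` factors. One `π/2` comes from Cauchy–Schwarz, the other from the length of the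
interval; the second moment is not sharp, but only finiteness matters. -/
lemma double_poincare_gaussian {n : ℕ} {p : E n → ℝ} (hp : IsStdNormal p) {u : E n → ℝ}
    (hu : Differentiable ℝ u) :
    ∫⁻ x, ∫⁻ y, ‖u x - u y‖ₑ ^ 2 ∂dens p ∂dens p ≤
      ENNReal.ofReal (Real.pi / 2) ^ 2 * (∫⁻ x, ‖x‖ₑ ^ 2 ∂dens p) *
        ∫⁻ x, ‖∇ u x‖ₑ ^ 2 ∂dens p := by
  have hprob := IsPrior.isProbabilityMeasure (Or.inr hp)
  have hgm : Measurable (∇ u) := measurable_gradient u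
  have hum : Measurable u := hu.continuous.measurable
  set F : E n × E n → ℝ≥0∞ := fun q => ‖∇ u q.1‖ₑ ^ 2 * ‖q.2‖ₑ ^ 2 with hFdef
  have hF : Measurable F := by fun_prop
  have hpt : ∀ q : E n × E n, ‖u q.1 - u q.2‖ₑ ^ 2 ≤ ENNReal.ofReal (Real.pi / 2) *
      ∫⁻ t in Set.Ioc 0 (Real.pi / 2), F (rot (Real.sin t) (Real.cos t) q) := by
    rintro ⟨x, y⟩
    have hder : ∀ t, HasDerivAt (fun t : ℝ => u (Real.sin t • x + Real.cos t • y))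
        (fderiv ℝ u (Real.sin t • x + Real.cos t • y) (Real.cos t • x - Real.sin t • y)) t := by
      intro t
      have h2 : HasDerivAt (fun t : ℝ => Real.sin t • x + Real.cos t • y)
          (Real.cos t • x - Real.sin t • y) t := by
        exact (((Real.hasDerivAt_sin t).smul_const x).add
          ((Real.hasDerivAt_cos t).smul_const y)).congr_deriv
          (by rw [neg_smul, sub_eq_add_neg])
      exact (hu _).hasFDerivAt.comp_hasDerivAt t h2
    have h := enorm_sub_sq_le_lintegral_deriv
      (v := fun t : ℝ => u (Real.sin t • x + Real.cos t • y)) (a := 0) (b := Real.pi / 2)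
      (by positivity) fun t _ => (hder t).differentiableAt
    simp only [Real.sin_pi_div_two, Real.cos_pi_div_two, Real.sin_zero, Real.cos_zero, one_smul,
      zero_smul, add_zero, zero_add, sub_zero] at h
    refine h.trans ?_
    gcongr with t
    rw [(hder t).deriv, hFdef]
    simp only [rot]
    rw [enorm_gradient, ← mul_pow]
    gcongr
    exact ContinuousLinearMap.le_opENorm _ _
  have hrm : Measurable fun r : (E n × E n) × ℝ => F (rot (Real.sin r.2) (Real.cos r.2) r.1) := by
    refine hF.comp ?_
    unfold rot
    fun_prop
  calc ∫⁻ x, ∫⁻ y, ‖u x - u y‖ₑ ^ 2 ∂dens p ∂dens p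
      = ∫⁻ q, ‖u q.1 - u q.2‖ₑ ^ 2 ∂((dens p).prod (dens p)) := by
        rw [lintegral_prod _ (by fun_prop)]
    _ ≤ ∫⁻ q, (ENNReal.ofReal (Real.pi / 2) *
          ∫⁻ t in Set.Ioc 0 (Real.pi / 2), F (rot (Real.sin t) (Real.cos t) q))
          ∂((dens p).prod (dens p)) := lintegral_mono hpt
    _ = ENNReal.ofReal (Real.pi / 2) * ∫⁻ t in Set.Ioc 0 (Real.pi / 2),
          ∫⁻ q, F (rot (Real.sin t) (Real.cos t) q) ∂((dens p).prod (dens p)) := by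
        rw [lintegral_const_mul _ (Measurable.lintegral_prod_right' hrm)]
        congr 1
        exact lintegral_lintegral_swap (f := fun q (t : ℝ) =>
          F (rot (Real.sin t) (Real.cos t) q)) hrm.aemeasurable
    _ = ENNReal.ofReal (Real.pi / 2) * ∫⁻ _ in Set.Ioc 0 (Real.pi / 2),
          (∫⁻ x, ‖∇ u x‖ₑ ^ 2 ∂dens p) * ∫⁻ x, ‖x‖ₑ ^ 2 ∂dens p := by
        congr 1
        refine lintegral_congr fun t => ?_
        rw [lintegral_gaussian_rot hp (Real.sin_sq_add_cos_sq t) hF, hFdef,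
          lintegral_prod_mul (f := fun x => ‖∇ u x‖ₑ ^ 2) (g := fun x : E n => ‖x‖ₑ ^ 2)
            (by fun_prop) (by fun_prop)]
    _ = _ := by
        rw [setLIntegral_const, Real.volume_Ioc, sub_zero]
        ring

/-! ### From the double integral to integrability and variance. -/

/-- The Poincaré inequality in double integral form, for `u` that need not be square integrable. -/
def DoublePoincare {n : ℕ} (p : E n → ℝ) (K : ℝ≥0) : Prop :=
  ∀ u : E n → ℝ, DifferentiableOn ℝ u (support p) →
    ∫⁻ x, ∫⁻ y, ‖u x - u y‖ₑ ^ 2 ∂dens p ∂dens p ≤ K * ∫⁻ x, ‖∇ u x‖ₑ ^ 2 ∂dens p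

lemma doublePoincare_gaussian (n : ℕ) :
    ∃ K : ℝ≥0, ∀ p : E n → ℝ, IsStdNormal p → DoublePoincare p K := by
  have h := lintegral_sq_norm_stdNormal_lt_top (n := n) rfl
  lift ∫⁻ x : E n, ‖x‖ₑ ^ 2 ∂dens fun x => (2 * Real.pi) ^ (-(n : ℝ) / 2) *
    Real.exp (-‖x‖ ^ 2 / 2) to ℝ≥0 using h.ne with B hB
  refine ⟨(Real.pi / 2).toNNReal ^ 2 * B, fun p hp u hu => ?_⟩
  have hu' : Differentiable ℝ u := by
    rwa [hp.support_eq, differentiableOn_univ] at hu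
  rw [ENNReal.coe_mul, hB, ENNReal.coe_pow]
  have := double_poincare_gaussian hp hu'
  rw [IsStdNormal] at hp
  subst hp
  exact this

/-- Normalizing both integrals cancels the factor `volume X`, so the constant depends only on
diameter and dimension and serves all slices of a given set at once. -/
lemma doublePoincare_uniform {n : ℕ} {X : Set (E n)} (hX : IsOpen X) (hc : Convex ℝ X)
    (hb : Bornology.IsBounded X) (hne : X.Nonempty) {D : ℝ≥0}
    (hD : ∀ x ∈ X, ∀ y ∈ X, ‖x - y‖ₑ ≤ D) :
    DoublePoincare (X.indicator fun _ => (volume.real X)⁻¹) (D ^ 2 * 2 ^ n) := by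
  intro u hu
  rw [support_indicator (inv_pos.2 (volume_real_pos hX hb hne))] at hu
  have h0 : volume X ≠ 0 := (hX.measure_pos _ hne).ne'
  have h1 : volume X ≠ ⊤ := hb.measure_lt_top.ne
  have h := double_poincare_convex hX hc hD hu
  rw [dens_uniform hX hb hne]
  simp only [lintegral_smul_measure, smul_eq_mul]
  rw [lintegral_const_mul' _ _ (ENNReal.inv_ne_top.2 h0)]
  push_cast
  calc (volume X)⁻¹ * ((volume X)⁻¹ * ∫⁻ x in X, ∫⁻ y in X, ‖u x - u y‖ₑ ^ 2)
      ≤ (volume X)⁻¹ * ((volume X)⁻¹ * (D ^ 2 * 2 ^ n * volume X * ∫⁻ x in X, ‖∇ u x‖ₑ ^ 2)) := by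
        gcongr
    _ = (volume X)⁻¹ * volume X *
          (D ^ 2 * 2 ^ n * ((volume X)⁻¹ * ∫⁻ x in X, ‖∇ u x‖ₑ ^ 2)) := by ring
    _ = _ := by rw [ENNReal.inv_mul_cancel h0 h1, one_mul]

lemma exists_diam_bound {n : ℕ} {X : Set (E n)} (hb : Bornology.IsBounded X) :
    ∃ D : ℝ≥0, ∀ x ∈ X, ∀ y ∈ X, ‖x - y‖ₑ ≤ D := by
  obtain ⟨C, hC⟩ := Metric.isBounded_iff_nndist.1 hb
  refine ⟨C, fun x hx y hy => ?_⟩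
  rw [← edist_eq_enorm_sub, edist_nndist]
  exact_mod_cast hC hx hy

lemma IsPrior.exists_doublePoincare {n : ℕ} {p : E n → ℝ} (hp : IsPrior p) :
    ∃ K : ℝ≥0, DoublePoincare p K := by
  rcases hp with ⟨X, hX, hc, hb, hne, rfl⟩ | hp
  · obtain ⟨D, hD⟩ := exists_diam_bound hb
    exact ⟨_, doublePoincare_uniform hX hc hb hne hD⟩
  · obtain ⟨K, hK⟩ := doublePoincare_gaussian n
    exact ⟨K, hK p hp⟩

/-- A function on the support of `p` whose gradient is square integrable is itself square
integrable. -/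
lemma DoublePoincare.memLp {n : ℕ} {p : E n → ℝ} (hp : IsPrior p) {K : ℝ≥0}
    (hK : DoublePoincare p K) {u : E n → ℝ} (hu : DifferentiableOn ℝ u (support p))
    (hg : ∫⁻ x, ‖∇ u x‖ₑ ^ 2 ∂dens p < ⊤) : MemLp u 2 (dens p) := by
  have hprob := hp.isProbabilityMeasure
  have hum := aestronglyMeasurable_dens hp.measurable hp.isOpen_support hu.continuousOn
  have hfin : ∫⁻ x, ∫⁻ y, ‖u x - u y‖ₑ ^ 2 ∂dens p ∂dens p < ⊤ :=
    (hK u hu).trans_lt (ENNReal.mul_lt_top ENNReal.coe_lt_top hg)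
  have hm2 : AEMeasurable (fun x => ∫⁻ y, ‖u x - u y‖ₑ ^ 2 ∂dens p) (dens p) := by
    have : AEMeasurable (fun q : E n × E n => ‖u q.1 - u q.2‖ₑ ^ 2)
        ((dens p).prod (dens p)) :=
      ((hum.comp_fst.sub hum.comp_snd).enorm).pow_const 2
    exact this.lintegral_prod_right'
  -- A single `x` with finite inner integral suffices: `u x - u` is then square integrable, and so
  -- is the constant `u x`.
  obtain ⟨x, hx⟩ := (ae_lt_top' hm2 hfin.ne).exists
  have h1 : MemLp (fun y => u x - u y) 2 (dens p) := by
    refine ⟨aestronglyMeasurable_const.sub hum, ?_⟩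
    rw [eLpNorm_lt_top_iff_lintegral_rpow_enorm_lt_top (by norm_num) (by norm_num)]
    simpa using hx
  have h2 := (memLp_const (u x) (p := 2) (μ := dens p)).sub h1
  refine h2.ae_eq (ae_of_all _ fun y => ?_)
  simp

lemma memLp_two_iff {n : ℕ} {p : E n → ℝ} {F : Type*} [NormedAddCommGroup F] {u : E n → F}
    (hu : AEStronglyMeasurable u (dens p)) :
    MemLp u 2 (dens p) ↔ ∫⁻ x, ‖u x‖ₑ ^ 2 ∂dens p < ⊤ := by
  rw [MemLp, and_iff_right hu,
    eLpNorm_lt_top_iff_lintegral_rpow_enorm_lt_top (by norm_num) (by norm_num)]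
  simp

lemma ofReal_integral_sq {n : ℕ} {p : E n → ℝ} {F : Type*} [NormedAddCommGroup F] {u : E n → F}
    (hu : MemLp u 2 (dens p)) :
    ENNReal.ofReal (∫ x, ‖u x‖ ^ 2 ∂dens p) = ∫⁻ x, ‖u x‖ₑ ^ 2 ∂dens p := by
  rw [ofReal_integral_eq_lintegral_ofReal hu.norm.integrable_sq
    (ae_of_all _ fun x => by positivity)]
  refine lintegral_congr fun x => ?_
  rw [ENNReal.ofReal_pow (norm_nonneg _), ofReal_norm]

lemma DoublePoincare.poincareIneq {n : ℕ} {p : E n → ℝ} (hp : IsPrior p) {K : ℝ≥0}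
    (hK : DoublePoincare p K) : PoincareIneq p K := by
  intro u hu hu2 hg2
  change MemLp u 2 (dens p) at hu2
  change MemLp (fun z => ∇ u z) 2 (dens p) at hg2
  have hprob := hp.isProbabilityMeasure
  rw [← integral_dens hp.measurable hp.nonneg, ← integral_dens hp.measurable hp.nonneg,
    ← integral_dens hp.measurable hp.nonneg]
  have hv : MemLp (fun z => u z - ∫ z', u z' ∂dens p) 2 (dens p) := hu2.sub (memLp_const _)
  have hl : ENNReal.ofReal (∫ z, (u z - ∫ z', u z' ∂dens p) ^ 2 ∂dens p) ≤
      ENNReal.ofReal (K * ∫ z, ‖∇ u z‖ ^ 2 ∂dens p) := by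
    have h := ofReal_integral_sq hv
    simp only [Real.norm_eq_abs, sq_abs] at h
    rw [h, ENNReal.ofReal_mul K.coe_nonneg, ofReal_integral_sq hg2, ENNReal.ofReal_coe_nnreal]
    refine le_trans (lintegral_mono fun x => ?_) (hK u hu)
    -- The deviation from the mean is the average of `u x - u z'`, so its square is at most the
    -- inner integral of the double integral.
    have h1 : u x - ∫ z', u z' ∂dens p = ∫ z', (u x - u z') ∂dens p := by
      rw [integral_sub (integrable_const _) (hu2.integrable (by norm_num))]
      simp
    rw [h1]
    have h2 := sq_lintegral_le (dens p) (φ := fun y => ‖u x - u y‖ₑ)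
      ((aestronglyMeasurable_const.sub hu2.1).enorm)
    rw [measure_univ, one_mul] at h2
    refine le_trans ?_ h2
    gcongr
    exact enorm_integral_le_lintegral_enorm _
  exact (ENNReal.ofReal_le_ofReal_iff (by positivity)).1 hl

/-! ### Orthogonal splitting of the variables -/

section Split

variable {k m : ℕ} {V : Matrix (Fin (k + m)) (Fin (k + m)) ℝ}

/-- The inactive variable `z = W₂ᵀ x`. -/
def inactiveVar (V : Matrix (Fin (k + m)) (Fin (k + m)) ℝ) (x : E (k + m)) : E m :=
  WithLp.toLp 2 ((colsInactive V).transpose.mulVec x.ofLp)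

lemma activeVar_combine (hV : V ∈ Matrix.orthogonalGroup (Fin (k + m)) ℝ) (y : E k) (z : E m) :
    activeVar V (combine V y z) = y := by
  have h := Matrix.mem_orthogonalGroup_iff' (Fin (k + m)) ℝ |>.1 hV
  have h1 : (colsActive V).transpose * colsActive V = 1 := by
    ext i j
    have := congrFun (congrFun h (Fin.castAdd m i)) (Fin.castAdd m j)
    simpa [Matrix.mul_apply, colsActive, Matrix.one_apply] using this
  have h2 : (colsActive V).transpose * colsInactive V = 0 := by
    ext i j
    have := congrFun (congrFun h (Fin.castAdd m i)) (Fin.natAdd k j)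
    simpa [Matrix.mul_apply, colsActive, colsInactive, Matrix.one_apply, Fin.ext_iff,
      (i.2.trans_le (Nat.le_add_right k j)).ne] using this
  simp [activeVar, combine, Matrix.mulVec_add, h1, h2]

lemma inactiveVar_combine (hV : V ∈ Matrix.orthogonalGroup (Fin (k + m)) ℝ) (y : E k) (z : E m) :
    inactiveVar V (combine V y z) = z := by
  have h := Matrix.mem_orthogonalGroup_iff' (Fin (k + m)) ℝ |>.1 hV
  have h1 : (colsInactive V).transpose * colsInactive V = 1 := by
    ext i j
    have := congrFun (congrFun h (Fin.natAdd k i)) (Fin.natAdd k j)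
    simpa [Matrix.mul_apply, colsInactive, Matrix.one_apply] using this
  have h2 : (colsInactive V).transpose * colsActive V = 0 := by
    ext i j
    have := congrFun (congrFun h (Fin.natAdd k i)) (Fin.castAdd m j)
    simpa [Matrix.mul_apply, colsActive, colsInactive, Matrix.one_apply, Fin.ext_iff,
      (j.2.trans_le (Nat.le_add_right k i)).ne'] using this
  simp [inactiveVar, combine, Matrix.mulVec_add, h1, h2]

/-- `x ↦ (V₁ᵀx, V₂ᵀx)` is the adjoint of `combine V`, for any matrix `V`. -/
lemma inner_combine (V : Matrix (Fin (k + m)) (Fin (k + m)) ℝ) (y : E k) (z : E m)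
    (x : E (k + m)) :
    inner ℝ (combine V y z) x = inner ℝ y (activeVar V x) + inner ℝ z (inactiveVar V x) := by
  simp only [EuclideanSpace.inner_eq_star_dotProduct, combine, activeVar, inactiveVar,
    star_trivial, dotProduct_add]
  rw [Matrix.dotProduct_mulVec, Matrix.dotProduct_mulVec, ← Matrix.mulVec_transpose,
    ← Matrix.mulVec_transpose]

lemma norm_sq_combine (hV : V ∈ Matrix.orthogonalGroup (Fin (k + m)) ℝ) (y : E k) (z : E m) :
    ‖combine V y z‖ ^ 2 = ‖y‖ ^ 2 + ‖z‖ ^ 2 := by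
  rw [← real_inner_self_eq_norm_sq, inner_combine, activeVar_combine hV, inactiveVar_combine hV,
    real_inner_self_eq_norm_sq, real_inner_self_eq_norm_sq]

lemma combine_add (V : Matrix (Fin (k + m)) (Fin (k + m)) ℝ) (y y' : E k) (z z' : E m) :
    combine V (y + y') (z + z') = combine V y z + combine V y' z' := by
  refine WithLp.ofLp_injective 2 ?_
  simp [combine, Matrix.mulVec_add]
  abel

lemma combine_smul (V : Matrix (Fin (k + m)) (Fin (k + m)) ℝ) (a : ℝ) (y : E k) (z : E m) :
    combine V (a • y) (a • z) = a • combine V y z := by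
  refine WithLp.ofLp_injective 2 ?_
  simp [combine, Matrix.mulVec_smul]

/-- The isometry `(y, z) ↦ V₁ y + V₂ z` for orthogonal `V = [V₁ V₂]`. -/
def combineIsometry (hV : V ∈ Matrix.orthogonalGroup (Fin (k + m)) ℝ) :
    WithLp 2 (E k × E m) ≃ₗᵢ[ℝ] E (k + m) :=
  LinearIsometry.toLinearIsometryEquiv
    { toFun := fun q => combine V q.ofLp.1 q.ofLp.2
      map_add' := fun p q => combine_add V _ _ _ _
      map_smul' := fun a q => combine_smul V _ _ _
      norm_map' := fun q => by
        rw [← sq_eq_sq₀ (norm_nonneg _) (norm_nonneg _)]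
        simpa [WithLp.prod_norm_sq_eq_of_L2] using norm_sq_combine hV q.ofLp.1 q.ofLp.2 }
    (by rw [(WithLp.linearEquiv 2 ℝ (E k × E m)).finrank_eq]; simp)

lemma measurePreserving_combine (hV : V ∈ Matrix.orthogonalGroup (Fin (k + m)) ℝ) :
    MeasurePreserving (fun q : E k × E m => combine V q.1 q.2) :=
  (combineIsometry hV).measurePreserving.comp (WithLp.volume_preserving_toLp (E k) (E m))

lemma combine_activeVar_inactiveVar (hV : V ∈ Matrix.orthogonalGroup (Fin (k + m)) ℝ)
    (x : E (k + m)) : combine V (activeVar V x) (inactiveVar V x) = x := by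
  obtain ⟨q, rfl⟩ := (combineIsometry hV).surjective x
  change combine V (activeVar V (combine V q.ofLp.1 q.ofLp.2)) (inactiveVar V (combine V _ _)) =
    combine V q.ofLp.1 q.ofLp.2
  rw [activeVar_combine hV, inactiveVar_combine hV]

/-- The linear map `z ↦ V₂ z`. -/
def embInactive (V : Matrix (Fin (k + m)) (Fin (k + m)) ℝ) : E m →L[ℝ] E (k + m) :=
  LinearMap.toContinuousLinearMap
    { toFun := fun z => combine V 0 z
      map_add' := fun z z' => by simpa using combine_add V 0 0 z z'
      map_smul' := fun a z => by simpa using combine_smul V a 0 z }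

lemma combine_eq (V : Matrix (Fin (k + m)) (Fin (k + m)) ℝ) (y : E k) (z : E m) :
    combine V y z = combine V y 0 + embInactive V z := by
  simpa [embInactive] using combine_add V y 0 0 z

lemma continuous_combine (V : Matrix (Fin (k + m)) (Fin (k + m)) ℝ) :
    Continuous fun q : E k × E m => combine V q.1 q.2 := by
  unfold combine
  fun_prop

lemma continuous_activeVar (V : Matrix (Fin (k + m)) (Fin (k + m)) ℝ) :
    Continuous (activeVar V) := by
  unfold activeVar
  fun_prop

lemma continuous_inactiveVar (V : Matrix (Fin (k + m)) (Fin (k + m)) ℝ) :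
    Continuous (inactiveVar V) := by
  unfold inactiveVar
  fun_prop

lemma hasGradientAt_comp_combine {f : E (k + m) → ℝ} {y : E k} {z : E m}
    (hf : DifferentiableAt ℝ f (combine V y z)) :
    HasGradientAt (fun z => f (combine V y z)) (inactiveVar V (∇ f (combine V y z))) z := by
  rw [hasGradientAt_iff_hasFDerivAt]
  have h1 : HasFDerivAt (fun z => combine V y z) (embInactive V) z := by
    rw [show (fun z => combine V y z) = fun z => combine V y 0 + embInactive V z from
      funext (combine_eq V y)]
    exact ((embInactive V).hasFDerivAt).const_add _
  refine (hf.hasFDerivAt.comp z h1).congr_fderiv ?_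
  ext w
  simp only [ContinuousLinearMap.comp_apply, InnerProductSpace.toDual_apply_apply]
  rw [← toDual_gradient, InnerProductSpace.toDual_apply_apply, real_inner_comm,
    real_inner_comm _ (inactiveVar V _)]
  simpa [embInactive] using inner_combine V 0 w (∇ f (combine V y z))

lemma mem_activeDomain_iff (hV : V ∈ Matrix.orthogonalGroup (Fin (k + m)) ℝ)
    {ρ : E (k + m) → ℝ} {y : E k} : y ∈ activeDomain ρ V ↔ ∃ z, 0 < ρ (combine V y z) := by
  constructor
  · rintro ⟨x, hx, rfl⟩
    exact ⟨inactiveVar V x, by rwa [combine_activeVar_inactiveVar hV]⟩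
  · rintro ⟨z, hz⟩
    exact ⟨_, hz, activeVar_combine hV y z⟩

end Split

/-! ### Conditional densities -/

section Cond

variable {k m : ℕ} {V : Matrix (Fin (k + m)) (Fin (k + m)) ℝ} {ρ : E (k + m) → ℝ}

/-- Orthogonality splits `‖x‖²` into `‖y‖² + ‖z‖²`, so the density factors and the `y` part cancels.
-/
lemma condDensity_stdNormal (hV : V ∈ Matrix.orthogonalGroup (Fin (k + m)) ℝ)
    (hρ : IsStdNormal ρ) (y : E k) : IsStdNormal (condDensity ρ V y) := by
  have h : ∀ z, ρ (combine V y z) = (2 * Real.pi) ^ (-(k : ℝ) / 2) * Real.exp (-‖y‖ ^ 2 / 2) *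
      ((2 * Real.pi) ^ (-(m : ℝ) / 2) * Real.exp (-‖z‖ ^ 2 / 2)) := by
    intro z
    subst hρ
    simp only
    rw [norm_sq_combine hV, mul_mul_mul_comm, ← Real.rpow_add (by positivity), ← Real.exp_add]
    congr 2
    · push_cast; ring
    · ring
  unfold IsStdNormal
  ext z
  have h0 : (0 : ℝ) < (2 * Real.pi) ^ (-(k : ℝ) / 2) * Real.exp (-‖y‖ ^ 2 / 2) := by positivity
  unfold condDensity marginal
  simp only [h]
  rw [integral_const_mul, integral_stdNormal, mul_one, mul_div_cancel_left₀ _ h0.ne']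

/-- The slice is the preimage of `X` under the affine isometry `z ↦ V₁y + V₂z`, which transfers
openness, convexity and the same bound `D`, whatever `V` and `y`. -/
lemma condDensity_uniform (hV : V ∈ Matrix.orthogonalGroup (Fin (k + m)) ℝ)
    {X : Set (E (k + m))} (hX : IsOpen X) (hc : Convex ℝ X) (hb : Bornology.IsBounded X)
    (hne : X.Nonempty) {D : ℝ≥0} (hD : ∀ x ∈ X, ∀ y ∈ X, ‖x - y‖ₑ ≤ D) {y : E k}
    (hy : y ∈ activeDomain (X.indicator fun _ => (volume.real X)⁻¹) V) :
    ∃ S : Set (E m), IsOpen S ∧ Convex ℝ S ∧ Bornology.IsBounded S ∧ S.Nonempty ∧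
      (∀ x ∈ S, ∀ y ∈ S, ‖x - y‖ₑ ≤ D) ∧
      condDensity (X.indicator fun _ => (volume.real X)⁻¹) V y =
        S.indicator fun _ => (volume.real S)⁻¹ := by
  have hv := volume_real_pos hX hb hne
  set S : Set (E m) := (fun z => combine V y z) ⁻¹' X with hS
  have hSo : IsOpen S := hX.preimage
    ((continuous_combine V).comp (continuous_const.prodMk continuous_id))
  have hSD : ∀ z ∈ S, ∀ z' ∈ S, ‖z - z'‖ₑ ≤ D := by
    intro z hz z' hz'
    refine le_trans (le_of_eq ?_) (hD _ hz _ hz')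
    have h1 : combine V y z - combine V y z' = combine V 0 (z - z') := by
      rw [sub_eq_iff_eq_add, ← combine_add]; simp
    have h2 := norm_sq_combine hV 0 (z - z')
    simp only [norm_zero, ne_eq, OfNat.ofNat_ne_zero, not_false_eq_true, zero_pow, zero_add] at h2
    rw [h1, ← ofReal_norm, ← ofReal_norm, (sq_eq_sq₀ (norm_nonneg _) (norm_nonneg _)).1 h2]
  have hSb : Bornology.IsBounded S := by
    refine Metric.isBounded_iff.2 ⟨D, fun z hz z' hz' => ?_⟩
    have := hSD z hz z' hz'
    rw [← edist_eq_enorm_sub, edist_nndist] at this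
    exact_mod_cast this
  have hSne : S.Nonempty := by
    obtain ⟨z, hz⟩ := (mem_activeDomain_iff hV).1 hy
    refine ⟨z, ?_⟩
    by_contra h
    rw [Set.indicator_of_notMem (show combine V y z ∉ X from h)] at hz
    exact lt_irrefl _ hz
  refine ⟨S, hSo, ?_, hSb, hSne, hSD, ?_⟩
  · intro z hz z' hz' a b ha hb' hab
    have := hc hz hz' ha hb' hab
    simp only [← combine_smul, ← combine_add] at this
    rwa [← add_smul, hab, one_smul] at this
  · have h1 : ∀ z, X.indicator (fun _ => (volume.real X)⁻¹) (combine V y z) =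
        S.indicator (fun _ => (volume.real X)⁻¹) z := fun z => rfl
    ext z
    unfold condDensity marginal
    simp only [h1]
    rw [integral_indicator hSo.measurableSet, setIntegral_const, smul_eq_mul]
    have hvS := volume_real_pos hSo hSb hSne
    by_cases hz : z ∈ S
    · simp only [Set.indicator_of_mem hz]
      field_simp
    · simp [hz]

lemma IsPrior.condDensity (hρ : IsPrior ρ) (hV : V ∈ Matrix.orthogonalGroup (Fin (k + m)) ℝ)
    {y : E k} (hy : y ∈ activeDomain ρ V) : IsPrior (condDensity ρ V y) := by
  rcases hρ with ⟨X, hX, hc, hb, hne, rfl⟩ | hρ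
  · obtain ⟨D, hD⟩ := exists_diam_bound hb
    obtain ⟨S, h1, h2, h3, h4, -, h5⟩ := condDensity_uniform hV hX hc hb hne hD hy
    exact Or.inl ⟨S, h1, h2, h3, h4, h5⟩
  · exact Or.inr (condDensity_stdNormal hV hρ y)

lemma IsPrior.exists_doublePoincare_cond (hρ : IsPrior ρ) :
    ∃ K : ℝ≥0, ∀ V ∈ Matrix.orthogonalGroup (Fin (k + m)) ℝ, ∀ y ∈ activeDomain ρ V,
      DoublePoincare (ActiveSubspace.condDensity ρ V y) K := by
  rcases hρ with ⟨X, hX, hc, hb, hne, rfl⟩ | hρ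
  · obtain ⟨D, hD⟩ := exists_diam_bound hb
    refine ⟨D ^ 2 * 2 ^ m, fun V hV y hy => ?_⟩
    obtain ⟨S, h1, h2, h3, h4, h5, h6⟩ := condDensity_uniform hV hX hc hb hne hD hy
    rw [h6]
    exact doublePoincare_uniform h1 h2 h3 h4 h5
  · obtain ⟨K, hK⟩ := doublePoincare_gaussian m
    exact ⟨K, fun V hV y _ => hK _ (condDensity_stdNormal hV hρ y)⟩

/-! ### The conditional Poincaré constant: finite, positive, admissible. -/

lemma IsPrior.condPoincareConst_lt_top (hρ : IsPrior ρ) :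
    condPoincareConst (k := k) (m := m) ρ < ⊤ := by
  obtain ⟨K, hK⟩ := hρ.exists_doublePoincare_cond
  refine lt_of_le_of_lt (b := (K : ℝ≥0∞)) ?_ ENNReal.coe_lt_top
  unfold condPoincareConst
  refine iSup₂_le fun V hV => iSup₂_le fun y hy => ?_
  exact iInf₂_le K ((hK V hV y hy).poincareIneq (hρ.condDensity hV hy))

/-- A coordinate function has gradient of norm one and positive variance, and its variance is a
lower bound for every admissible constant. -/
lemma IsPrior.poincareConst_pos {p : E m → ℝ} (hp : IsPrior p) (hm : 1 ≤ m) :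
    0 < poincareConst p := by
  have hprob := hp.isProbabilityMeasure
  let i : Fin m := ⟨0, hm⟩
  set u : E m → ℝ := fun z => z i with hu
  have hud : Differentiable ℝ u := by fun_prop
  have hgrad : ∀ z, ‖∇ u z‖ = 1 := by
    intro z
    have : HasGradientAt u (EuclideanSpace.single i (1 : ℝ)) z := by
      rw [hasGradientAt_iff_hasFDerivAt]
      refine (EuclideanSpace.proj (𝕜 := ℝ) i).hasFDerivAt.congr_fderiv ?_
      ext w
      simp [EuclideanSpace.inner_single_left]
    rw [this.gradient]
    simp
  have hg2 : MemLp (fun z => ∇ u z) 2 (dens p) := by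
    refine MemLp.of_bound (measurable_gradient u).aestronglyMeasurable 1 (ae_of_all _ fun z => ?_)
    rw [hgrad]
  obtain ⟨K, hK⟩ := hp.exists_doublePoincare
  have hu2 : MemLp u 2 (dens p) :=
    hK.memLp hp hud.differentiableOn ((memLp_two_iff hg2.1).1 hg2)
  set v : ℝ := ∫ z, (u z - ∫ z', u z' * p z') ^ 2 * p z with hv
  have hvpos : 0 < v := by
    rw [hv, ← integral_dens hp.measurable hp.nonneg, ← integral_dens hp.measurable hp.nonneg]
    set a := ∫ z, u z ∂dens p
    have hint : Integrable (fun z => (u z - a) ^ 2) (dens p) :=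
      (hu2.sub (memLp_const a)).integrable_sq
    refine lt_of_le_of_ne (integral_nonneg fun z => sq_nonneg _) fun h => ?_
    rw [eq_comm, integral_eq_zero_iff_of_nonneg (fun z => sq_nonneg _) hint] at h
    unfold dens at h
    rw [Filter.EventuallyEq, ae_withDensity_iff hp.measurable.ennreal_ofReal] at h
    -- Zero variance would make `u` constant almost everywhere, hence by continuity on the open
    -- support, contradicting the gradient of norm one.
    have hz : ∀ z ∈ support p, u z = a := by
      have h3 : u =ᵐ[volume.restrict (support p)] fun _ => a := by
        rw [Filter.EventuallyEq, ae_restrict_iff' hp.isOpen_support.measurableSet]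
        filter_upwards [h] with z hz hzs
        have := hz (ENNReal.ofReal_pos.2 hzs).ne'
        simpa [sub_eq_zero] using this
      exact Measure.eqOn_open_of_ae_eq h3 hp.isOpen_support hud.continuous.continuousOn
        continuousOn_const
    obtain ⟨z, hzs⟩ := hp.nonempty_support
    have h4 : u =ᶠ[nhds z] fun _ => a := by
      filter_upwards [hp.isOpen_support.mem_nhds hzs] with w hw using hz w hw
    have h5 : ∇ u z = 0 := by
      rw [h4.gradient_eq]; simp [gradient]
    have := hgrad z
    simp [h5] at this
  refine lt_of_lt_of_le (ENNReal.ofReal_pos.2 hvpos) ?_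
  unfold poincareConst
  refine le_iInf₂ fun c hc => ?_
  have h := hc u hud.differentiableOn hu2 hg2
  simp only [hgrad, one_pow, one_mul, hp.integral_eq_one, mul_one] at h
  rw [← ENNReal.ofReal_coe_nnreal]
  exact ENNReal.ofReal_le_ofReal h

lemma IsPrior.condPoincareConst_pos (hρ : IsPrior ρ) (hm : 1 ≤ m) :
    0 < condPoincareConst (k := k) (m := m) ρ := by
  obtain ⟨x, hx⟩ := hρ.nonempty_support
  have h1 : (1 : Matrix (Fin (k + m)) (Fin (k + m)) ℝ) ∈ Matrix.orthogonalGroup _ ℝ := one_mem _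
  have hy : activeVar 1 x ∈ activeDomain ρ (1 : Matrix (Fin (k + m)) (Fin (k + m)) ℝ) :=
    ⟨x, hx, rfl⟩
  refine ((hρ.condDensity h1 hy).poincareConst_pos hm).trans_le ?_
  unfold condPoincareConst
  exact le_iSup₂_of_le 1 h1 (le_iSup₂_of_le _ hy le_rfl)

/-- The infimum is attained: the inequality is closed in the constant, so it passes to the limit
from admissible values. -/
lemma PoincareIneq.of_poincareConst_le {p : E m → ℝ} (h0 : ∀ z, 0 ≤ p z) {C : ℝ≥0}
    (hC : poincareConst p ≤ C) :
    PoincareIneq p C := by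
  intro u hu hu2 hg2
  set v := ∫ z : E m, (u z - ∫ z' : E m, u z' * p z') ^ 2 * p z
  set e := ∫ z : E m, ‖∇ u z‖ ^ 2 * p z
  have key : ∀ a : ℝ≥0, C < a → ∃ c ≤ a, v ≤ (c : ℝ) * e := by
    intro a ha
    have : poincareConst p < a := hC.trans_lt (by exact_mod_cast ha)
    unfold poincareConst at this
    simp only [iInf_lt_iff] at this
    obtain ⟨c, hc, hca⟩ := this
    exact ⟨c, by exact_mod_cast hca.le, hc u hu hu2 hg2⟩
  rcases le_or_gt e 0 with he | he
  · obtain ⟨c, -, hc⟩ := key (C + 1) (by simp)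
    have he0 : e = 0 := le_antisymm he (integral_nonneg fun z => mul_nonneg (sq_nonneg _) (h0 z))
    simpa [he0] using hc
  · rw [← div_le_iff₀ he]
    refine le_of_forall_gt_imp_ge_of_dense fun a ha => ?_
    obtain ⟨c, hc, h⟩ := key ⟨a, C.coe_nonneg.trans ha.le⟩ ha
    rw [div_le_iff₀ he]
    exact h.trans (by gcongr; exact hc)

end Cond

/-! ### The conditional mean approximation -/

section Approx

variable {k m : ℕ} {V : Matrix (Fin (k + m)) (Fin (k + m)) ℝ} {ρ f : E (k + m) → ℝ}

lemma norm_sq_activeVar_add (hV : V ∈ Matrix.orthogonalGroup (Fin (k + m)) ℝ) (x : E (k + m)) :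
    ‖activeVar V x‖ ^ 2 + ‖inactiveVar V x‖ ^ 2 = ‖x‖ ^ 2 := by
  rw [← norm_sq_combine hV, combine_activeVar_inactiveVar hV]

lemma norm_inactiveVar_le (hV : V ∈ Matrix.orthogonalGroup (Fin (k + m)) ℝ) (x : E (k + m)) :
    ‖inactiveVar V x‖ ≤ ‖x‖ := by
  rw [← sq_le_sq₀ (norm_nonneg _) (norm_nonneg _), ← norm_sq_activeVar_add hV x]
  linarith [sq_nonneg ‖activeVar V x‖]

lemma measurable_combine (V : Matrix (Fin (k + m)) (Fin (k + m)) ℝ) :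
    Measurable fun q : E k × E m => combine V q.1 q.2 :=
  (continuous_combine V).measurable

lemma combine_notMem_activeDomain (hρ : IsPrior ρ)
    (hV : V ∈ Matrix.orthogonalGroup (Fin (k + m)) ℝ) {y : E k} (hy : y ∉ activeDomain ρ V)
    (z : E m) : ρ (combine V y z) = 0 := by
  rw [mem_activeDomain_iff hV] at hy
  push Not at hy
  exact le_antisymm (hy z) (hρ.nonneg _)

lemma marginal_pos (hρ : IsPrior ρ) (hV : V ∈ Matrix.orthogonalGroup (Fin (k + m)) ℝ) {y : E k}
    (hy : y ∈ activeDomain ρ V) : 0 < marginal ρ V y := by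
  refine lt_of_le_of_ne (integral_nonneg fun z => hρ.nonneg _) fun h => ?_
  have h1 := (hρ.condDensity hV hy).integral_eq_one
  unfold condDensity at h1
  rw [← h] at h1
  simp at h1

lemma condDensity_mul_marginal (hρ : IsPrior ρ)
    (hV : V ∈ Matrix.orthogonalGroup (Fin (k + m)) ℝ) (y : E k) (z : E m) :
    condDensity ρ V y z * marginal ρ V y = ρ (combine V y z) := by
  by_cases hy : y ∈ activeDomain ρ V
  · exact div_mul_cancel₀ _ (marginal_pos hρ hV hy).ne'
  · simp [condDensity, combine_notMem_activeDomain hρ hV hy]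

lemma measurable_marginal (hρ : IsPrior ρ) (V : Matrix (Fin (k + m)) (Fin (k + m)) ℝ) :
    Measurable (marginal ρ V) :=
  (StronglyMeasurable.integral_prod_right (f := fun y z => ρ (combine V y z))
    (hρ.measurable.comp (measurable_combine V)).stronglyMeasurable).measurable

/-- Off the support `f` may fail to be measurable, but there the factor `ρ` vanishes. -/
lemma measurable_mul_prior (hρ : IsPrior ρ) (hf : DifferentiableOn ℝ f (support ρ)) :
    Measurable fun x => f x * ρ x := by
  classical
  have h1 : Measurable ((support ρ).piecewise f 0) :=
    hf.continuousOn.measurable_piecewise continuousOn_const hρ.isOpen_support.measurableSet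
  have h2 : (fun x => f x * ρ x) = fun x => (support ρ).piecewise f 0 x * ρ x := by
    ext x
    by_cases hx : x ∈ support ρ
    · simp [hx]
    · simp [hx, le_antisymm (not_lt.1 hx) (hρ.nonneg x)]
  rw [h2]
  exact h1.mul hρ.measurable

lemma measurable_condMean (hρ : IsPrior ρ) (hf : DifferentiableOn ℝ f (support ρ))
    (V : Matrix (Fin (k + m)) (Fin (k + m)) ℝ) : Measurable (condMean ρ f V) := by
  refine (StronglyMeasurable.integral_prod_right
    (f := fun y z => f (combine V y z) * condDensity ρ V y z) ?_).measurable
  have h : Measurable fun q : E k × E m =>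
      (f (combine V q.1 q.2) * ρ (combine V q.1 q.2)) / marginal ρ V q.1 :=
    ((measurable_mul_prior hρ hf).comp (measurable_combine V)).div
      ((measurable_marginal hρ V).comp measurable_fst)
  simp only [mul_div_assoc] at h
  exact h.stronglyMeasurable

lemma measurable_ridgeApprox (hρ : IsPrior ρ) (hf : DifferentiableOn ℝ f (support ρ))
    (V : Matrix (Fin (k + m)) (Fin (k + m)) ℝ) : Measurable (ridgeApprox ρ f V) :=
  (measurable_condMean hρ hf V).comp (continuous_activeVar V).measurable

lemma lintegral_dens_fiber (hρ : IsPrior ρ) (hV : V ∈ Matrix.orthogonalGroup (Fin (k + m)) ℝ)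
    {H : E (k + m) → ℝ≥0∞} (hH : AEMeasurable H (dens ρ)) :
    ∫⁻ x, H x ∂dens ρ = ∫⁻ y, ENNReal.ofReal (marginal ρ V y) *
      ∫⁻ z, H (combine V y z) ∂dens (condDensity ρ V y) := by
  have hm : AEMeasurable (fun x => ENNReal.ofReal (ρ x) * H x) :=
    (aemeasurable_withDensity_ennreal_iff hρ.measurable.real_toNNReal).1 hH
  have hMP := measurePreserving_combine hV
  have hm' : AEMeasurable (fun q : E k × E m =>
      ENNReal.ofReal (ρ (combine V q.1 q.2)) * H (combine V q.1 q.2)) :=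
    hm.comp_quasiMeasurePreserving hMP.quasiMeasurePreserving
  rw [lintegral_dens hρ.measurable, ← hMP.map_eq, lintegral_map' (by rwa [hMP.map_eq])
    hMP.measurable.aemeasurable, Measure.volume_eq_prod, lintegral_prod _ hm']
  refine lintegral_congr fun y => ?_
  have hcm : Measurable (condDensity ρ V y) :=
    (hρ.measurable.comp ((measurable_combine V).comp measurable_prodMk_left)).div_const _
  rw [lintegral_dens hcm, ← lintegral_const_mul' _ _ ENNReal.ofReal_ne_top]
  refine lintegral_congr fun z => ?_
  have h0 : 0 ≤ marginal ρ V y := integral_nonneg fun z => hρ.nonneg _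
  rw [← mul_assoc, ← ENNReal.ofReal_mul h0,
    mul_comm (marginal _ _ _), condDensity_mul_marginal hρ hV]

lemma fiber_poincare (hρ : IsPrior ρ) (hV : V ∈ Matrix.orthogonalGroup (Fin (k + m)) ℝ)
    (hf : DifferentiableOn ℝ f (support ρ)) {C : ℝ≥0} (hC0 : 0 < C) {y : E k}
    (hy : y ∈ activeDomain ρ V) (hC : PoincareIneq (condDensity ρ V y) C) :
    ∫⁻ z, ‖f (combine V y z) - condMean ρ f V y‖ₑ ^ 2 ∂dens (condDensity ρ V y) ≤
      C * ∫⁻ z, ‖inactiveVar V (∇ f (combine V y z))‖ₑ ^ 2 ∂dens (condDensity ρ V y) := by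
  have hp := hρ.condDensity hV hy
  have hprob := hp.isProbabilityMeasure
  -- With infinite gradient energy the right side is `∞`, because `C > 0`.
  by_cases htop : ∫⁻ z, ‖inactiveVar V (∇ f (combine V y z))‖ₑ ^ 2 ∂dens (condDensity ρ V y) = ⊤
  · rw [htop, ENNReal.mul_top (by exact_mod_cast hC0.ne')]
    exact le_top
  set u : E m → ℝ := fun z => f (combine V y z) with hu
  have hsupp : ∀ z ∈ support (condDensity ρ V y), combine V y z ∈ support ρ := by
    intro z hz
    have h := condDensity_mul_marginal hρ hV y z
    exact (mul_pos hz (marginal_pos hρ hV hy)).trans_eq h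
  have hgrad : ∀ z ∈ support (condDensity ρ V y),
      HasGradientAt u (inactiveVar V (∇ f (combine V y z))) z := fun z hz =>
    hasGradientAt_comp_combine (hf.differentiableAt (hρ.isOpen_support.mem_nhds (hsupp z hz)))
  have hud : DifferentiableOn ℝ u (support (condDensity ρ V y)) := fun z hz =>
    (hgrad z hz).differentiableAt.differentiableWithinAt
  have heq : ∫⁻ z, ‖∇ u z‖ₑ ^ 2 ∂dens (condDensity ρ V y) =
      ∫⁻ z, ‖inactiveVar V (∇ f (combine V y z))‖ₑ ^ 2 ∂dens (condDensity ρ V y) := by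
    refine lintegral_congr_ae ?_
    filter_upwards [ae_dens hp.measurable] with z hz
    rw [(hgrad z hz).gradient]
  rw [← heq] at htop ⊢
  -- The value of `K` is irrelevant; it only supplies the square integrability of `u` that the
  -- inequality with constant `C` presupposes.
  obtain ⟨K, hK⟩ := hp.exists_doublePoincare
  have hu2 := hK.memLp hp hud (lt_top_iff_ne_top.2 htop)
  have hg2 : MemLp (fun z => ∇ u z) 2 (dens (condDensity ρ V y)) :=
    (memLp_two_iff (measurable_gradient u).aestronglyMeasurable).2 (lt_top_iff_ne_top.2 htop)
  have h := hC u hud hu2 hg2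
  rw [← integral_dens hp.measurable hp.nonneg (fun z => ‖∇ u z‖ ^ 2),
    ← integral_dens hp.measurable hp.nonneg (fun z => (u z - _) ^ 2)] at h
  have hv := ofReal_integral_sq
    (hu2.sub (memLp_const (∫ z', u z' * condDensity ρ V y z')))
  simp only [Pi.sub_apply, Real.norm_eq_abs, sq_abs] at hv
  change ∫⁻ z, ‖u z - ∫ z', u z' * condDensity ρ V y z'‖ₑ ^ 2 ∂dens (condDensity ρ V y) ≤ _
  rw [← hv, ← ofReal_integral_sq hg2, ← ENNReal.ofReal_coe_nnreal,
    ← ENNReal.ofReal_mul C.coe_nonneg]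
  exact ENNReal.ofReal_le_ofReal h

lemma lintegral_ridgeApprox_error_le (hρ : IsPrior ρ)
    (hV : V ∈ Matrix.orthogonalGroup (Fin (k + m)) ℝ) (hf : DifferentiableOn ℝ f (support ρ))
    {C : ℝ≥0} (hC0 : 0 < C)
    (hC : ∀ y ∈ activeDomain ρ V, PoincareIneq (condDensity ρ V y) C) :
    ∫⁻ x, ‖f x - ridgeApprox ρ f V x‖ₑ ^ 2 ∂dens ρ ≤
      C * ∫⁻ x, ‖inactiveVar V (∇ f x)‖ₑ ^ 2 ∂dens ρ := by
  have hfm := aestronglyMeasurable_dens hρ.measurable hρ.isOpen_support hf.continuousOn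
  have hrm := measurable_ridgeApprox hρ hf V
  have hgm : Measurable fun x => inactiveVar V (∇ f x) :=
    (continuous_inactiveVar V).measurable.comp (measurable_gradient f)
  rw [lintegral_dens_fiber hρ hV (H := fun x => ‖f x - ridgeApprox ρ f V x‖ₑ ^ 2)
      ((hfm.sub hrm.aestronglyMeasurable).enorm.pow_const 2),
    lintegral_dens_fiber hρ hV (hgm.enorm.pow_const 2).aemeasurable,
    ← lintegral_const_mul' _ _ ENNReal.coe_ne_top]
  refine lintegral_mono fun y => ?_
  by_cases hy : y ∈ activeDomain ρ V
  · rw [mul_left_comm]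
    refine mul_le_mul' le_rfl ?_
    simp only [ridgeApprox, activeVar_combine hV]
    exact fiber_poincare hρ hV hf hC0 hy (hC y hy)
  · have : marginal ρ V y = 0 := by
      simp [marginal, combine_notMem_activeDomain hρ hV hy]
    simp [this]

/-- Tower property: `f_g` is constant on each fiber, where it equals the conditional mean of `f`. -/
lemma integral_ridgeApprox (hρ : IsPrior ρ) (hV : V ∈ Matrix.orthogonalGroup (Fin (k + m)) ℝ)
    (hf : Integrable f (dens ρ)) (hg : Integrable (ridgeApprox ρ f V) (dens ρ)) :
    ∫ x, ridgeApprox ρ f V x ∂dens ρ = ∫ x, f x ∂dens ρ := by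
  have hMP := measurePreserving_combine hV
  have key : ∀ h : E (k + m) → ℝ, Integrable h (dens ρ) →
      ∫ x, h x ∂dens ρ = ∫ y, ∫ z, h (combine V y z) * ρ (combine V y z) := by
    intro h hh
    rw [integrable_dens hρ.measurable hρ.nonneg] at hh
    rw [integral_dens hρ.measurable hρ.nonneg, ← hMP.map_eq,
      integral_map hMP.measurable.aemeasurable (by rw [hMP.map_eq]; exact hh.1),
      Measure.volume_eq_prod, integral_prod]
    exact hMP.integrable_comp_of_integrable hh
  rw [key _ hf, key _ hg]
  refine integral_congr_ae (ae_of_all _ fun y => ?_)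
  simp only [ridgeApprox, activeVar_combine hV]
  rw [integral_const_mul]
  change condMean ρ f V y * marginal ρ V y = _
  unfold condMean
  rw [← integral_mul_const]
  refine integral_congr_ae (ae_of_all _ fun z => ?_)
  simp only
  rw [mul_assoc, condDensity_mul_marginal hρ hV]

end Approx

/-! ### The perturbed eigenvectors -/

section Perturbation

variable {k m : ℕ}

/-- Write `x = W₁y + W₂z`. Since `V₂ᵀV₁ = 0`, `V₂ᵀW₁y = V₂ᵀ(W₁ - V₁)y` has norm at most `ε‖y‖`,
while `V₂ᵀW₂` is a contraction. -/
lemma norm_inactiveVar_perturb_le {W V : Matrix (Fin (k + m)) (Fin (k + m)) ℝ}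
    (hW : W ∈ Matrix.orthogonalGroup (Fin (k + m)) ℝ)
    (hV : V ∈ Matrix.orthogonalGroup (Fin (k + m)) ℝ) {ε : ℝ}
    (hε : ‖Matrix.toEuclideanCLM (𝕜 := ℝ) (W - V)‖ ≤ ε) (x : E (k + m)) :
    ‖inactiveVar V x‖ ≤ ε * ‖activeVar W x‖ + ‖inactiveVar W x‖ := by
  have hadd : ∀ x x', inactiveVar V (x + x') = inactiveVar V x + inactiveVar V x' := by
    intro x x'
    refine WithLp.ofLp_injective 2 ?_
    simp [inactiveVar, Matrix.mulVec_add]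
  -- Padding `y` with zeros turns `U₁y` into the full matrix applied to a vector, so that the
  -- spectral norm of `W - V` applies.
  have hcomb : ∀ (U : Matrix (Fin (k + m)) (Fin (k + m)) ℝ) (y : E k), combine U y 0 =
      Matrix.toEuclideanCLM (𝕜 := ℝ) U (WithLp.toLp 2 (Fin.append y.ofLp 0)) := by
    intro U y
    refine WithLp.ofLp_injective 2 ?_
    ext i
    simp [combine, Matrix.mulVec, dotProduct, Fin.sum_univ_add, colsActive]
  have hnorm : ∀ y : E k, ‖(WithLp.toLp 2 (Fin.append y.ofLp (0 : Fin m → ℝ)) : E (k + m))‖ =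
      ‖y‖ := by
    intro y
    rw [← sq_eq_sq₀ (norm_nonneg _) (norm_nonneg _), EuclideanSpace.norm_sq_eq,
      EuclideanSpace.norm_sq_eq]
    simp [Fin.sum_univ_add]
  set y := activeVar W x
  set z := inactiveVar W x
  have hx : x = combine W y 0 + combine W 0 z := by
    rw [← combine_add, add_zero, zero_add, combine_activeVar_inactiveVar hW]
  have h1 : inactiveVar V (combine W y 0) = inactiveVar V (combine W y 0 - combine V y 0) := by
    have := hadd (combine W y 0 - combine V y 0) (combine V y 0)
    rwa [sub_add_cancel, inactiveVar_combine hV, add_zero] at this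
  rw [hx, hadd, h1]
  refine (norm_add_le _ _).trans (add_le_add ?_ ?_)
  · refine (norm_inactiveVar_le hV _).trans ?_
    rw [hcomb, hcomb, ← sub_apply, ← map_sub, ← hnorm y]
    exact (ContinuousLinearMap.le_opNorm _ _).trans (by gcongr)
  · refine (norm_inactiveVar_le hV _).trans (le_of_eq ?_)
    rw [← sq_eq_sq₀ (norm_nonneg _) (norm_nonneg _), norm_sq_combine hW]
    simp

/-- The integral is the `i`-th diagonal entry of `Wᵀ (∫ ∇f ∇fᵀ ρ) W`. -/
lemma integral_sq_transpose_mulVec {n : ℕ} {ρ f : E n → ℝ} (hρ : IsPrior ρ)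
    (hg : MemLp (fun x => ∇ f x) 2 (dens ρ)) {W : Matrix (Fin n) (Fin n) ℝ} {lam : Fin n → ℝ}
    (hW : W ∈ Matrix.orthogonalGroup (Fin n) ℝ)
    (hM : gradOuter ρ f = W * Matrix.diagonal lam * W.transpose) (i : Fin n) :
    Integrable (fun x => (W.transpose.mulVec (∇ f x).ofLp i) ^ 2) (dens ρ) ∧
      ∫ x, (W.transpose.mulVec (∇ f x).ofLp i) ^ 2 ∂dens ρ = lam i := by
  have hcoord : ∀ j, MemLp (fun x => (∇ f x) j) 2 (dens ρ) := fun j =>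
    hg.continuousLinearMap_comp (EuclideanSpace.proj (𝕜 := ℝ) j)
  have hint : ∀ j l, Integrable (fun x => W j i * W l i * ((∇ f x) j * (∇ f x) l)) (dens ρ) :=
    fun j l => ((hcoord j).integrable_mul (hcoord l)).const_mul _
  have hexp : ∀ x, (W.transpose.mulVec (∇ f x).ofLp i) ^ 2 =
      ∑ j, ∑ l, W j i * W l i * ((∇ f x) j * (∇ f x) l) := by
    intro x
    simp only [Matrix.mulVec, dotProduct, Matrix.transpose_apply, sq, Finset.sum_mul_sum]
    refine Finset.sum_congr rfl fun j _ => Finset.sum_congr rfl fun l _ => by ring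
  have hsum : ∀ j, Integrable (fun x => ∑ l, W j i * W l i * ((∇ f x) j * (∇ f x) l)) (dens ρ) :=
    fun j => integrable_finsetSum _ fun l _ => hint j l
  simp_rw [hexp]
  refine ⟨integrable_finsetSum _ fun j _ => hsum j, ?_⟩
  rw [integral_finsetSum _ fun j _ => hsum j]
  have hW1 := (Matrix.mem_orthogonalGroup_iff' (Fin n) ℝ).1 hW
  change W.transpose * W = 1 at hW1
  have hdiag : (W.transpose * gradOuter ρ f * W) i i = lam i := by
    rw [hM, show W.transpose * (W * Matrix.diagonal lam * W.transpose) * W =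
      (W.transpose * W) * Matrix.diagonal lam * (W.transpose * W) by simp only [Matrix.mul_assoc],
      hW1]
    simp
  rw [← hdiag]
  simp only [Matrix.mul_apply, Finset.sum_mul, Matrix.transpose_apply]
  rw [Finset.sum_comm]
  refine Finset.sum_congr rfl fun j _ => ?_
  rw [integral_finsetSum _ fun l _ => hint _ _]
  refine Finset.sum_congr rfl fun l _ => ?_
  rw [integral_const_mul, integral_dens hρ.measurable hρ.nonneg]
  simp only [gradOuter, Matrix.of_apply]
  ring_nf

lemma lintegral_inactiveVar_perturb_le {ρ f : E (k + m) → ℝ} (hρ : IsPrior ρ)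
    (hg : MemLp (fun x => ∇ f x) 2 (dens ρ)) {W V : Matrix (Fin (k + m)) (Fin (k + m)) ℝ}
    {lam : Fin (k + m) → ℝ} (hW : W ∈ Matrix.orthogonalGroup (Fin (k + m)) ℝ)
    (hM : gradOuter ρ f = W * Matrix.diagonal lam * W.transpose)
    (hV : V ∈ Matrix.orthogonalGroup (Fin (k + m)) ℝ) {ε : ℝ} (hε0 : 0 ≤ ε)
    (hε : ‖Matrix.toEuclideanCLM (𝕜 := ℝ) (W - V)‖ ≤ ε) :
    ∫⁻ x, ‖inactiveVar V (∇ f x)‖ₑ ^ 2 ∂dens ρ ≤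
      ENNReal.ofReal ((ε * Real.sqrt (∑ i : Fin k, lam (Fin.castAdd m i)) +
            Real.sqrt (∑ j : Fin m, lam (Fin.natAdd k j))) ^ 2) := by
  have hI := integral_sq_transpose_mulVec hρ hg hW hM
  have hA : ∀ x, ‖activeVar W x‖ ^ 2 =
      ∑ i : Fin k, (W.transpose.mulVec x.ofLp (Fin.castAdd m i)) ^ 2 := by
    intro x
    rw [EuclideanSpace.norm_sq_eq]
    simp [activeVar, colsActive, Matrix.mulVec, dotProduct]
  have hB : ∀ x, ‖inactiveVar W x‖ ^ 2 =
      ∑ i : Fin m, (W.transpose.mulVec x.ofLp (Fin.natAdd k i)) ^ 2 := by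
    intro x
    rw [EuclideanSpace.norm_sq_eq]
    simp [inactiveVar, colsInactive, Matrix.mulVec, dotProduct]
  have hAm : AEStronglyMeasurable (fun x => activeVar W (∇ f x)) (dens ρ) :=
    (continuous_activeVar W).comp_aestronglyMeasurable hg.1
  have hBm : AEStronglyMeasurable (fun x => inactiveVar W (∇ f x)) (dens ρ) :=
    (continuous_inactiveVar W).comp_aestronglyMeasurable hg.1
  have hAL : MemLp (fun x => activeVar W (∇ f x)) 2 (dens ρ) := by
    rw [memLp_two_iff_integrable_sq_norm hAm]
    simp_rw [hA]
    exact integrable_finsetSum _ fun i _ => (hI _).1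
  have hBL : MemLp (fun x => inactiveVar W (∇ f x)) 2 (dens ρ) := by
    rw [memLp_two_iff_integrable_sq_norm hBm]
    simp_rw [hB]
    exact integrable_finsetSum _ fun i _ => (hI _).1
  have hAI : ∫ x, ‖activeVar W (∇ f x)‖ ^ 2 ∂dens ρ = ∑ i : Fin k, lam (Fin.castAdd m i) := by
    simp_rw [hA]
    rw [integral_finsetSum _ fun i _ => (hI _).1]
    exact Finset.sum_congr rfl fun i _ => (hI _).2
  have hBI : ∫ x, ‖inactiveVar W (∇ f x)‖ ^ 2 ∂dens ρ = ∑ i : Fin m, lam (Fin.natAdd k i) := by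
    simp_rw [hB]
    rw [integral_finsetSum _ fun i _ => (hI _).1]
    exact Finset.sum_congr rfl fun i _ => (hI _).2
  set α : E (k + m) → ℝ := fun x => ‖activeVar W (∇ f x)‖
  set β : E (k + m) → ℝ := fun x => ‖inactiveVar W (∇ f x)‖
  have hα : MemLp α 2 (dens ρ) := hAL.norm
  have hβ : MemLp β 2 (dens ρ) := hBL.norm
  set a := ∑ i : Fin k, lam (Fin.castAdd m i)
  set b := ∑ i : Fin m, lam (Fin.natAdd k i)
  have ha : 0 ≤ a := hAI ▸ integral_nonneg fun x => sq_nonneg _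
  have hb : 0 ≤ b := hBI ▸ integral_nonneg fun x => sq_nonneg _
  -- Cauchy–Schwarz for the cross term; expanding the square then gives Minkowski's inequality for
  -- `ε α + β`.
  have hcs : ∫ x, α x * β x ∂dens ρ ≤ Real.sqrt a * Real.sqrt b := by
    have h := integral_mul_le_Lp_mul_Lq_of_nonneg Real.HolderConjugate.two_two (μ := dens ρ)
      (f := α) (g := β) (ae_of_all _ fun x => norm_nonneg _) (ae_of_all _ fun x => norm_nonneg _)
      (by simpa using hα) (by simpa using hβ)
    simp only [Real.rpow_two] at h
    rwa [hAI, hBI, ← Real.sqrt_eq_rpow, ← Real.sqrt_eq_rpow] at h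
  have hsq : MemLp (fun x => ε * α x + β x) 2 (dens ρ) := (hα.const_mul ε).add hβ
  calc ∫⁻ x, ‖inactiveVar V (∇ f x)‖ₑ ^ 2 ∂dens ρ
      ≤ ∫⁻ x, ‖ε * α x + β x‖ₑ ^ 2 ∂dens ρ := by
        refine lintegral_mono fun x => ?_
        gcongr
        rw [← ofReal_norm, ← ofReal_norm]
        refine ENNReal.ofReal_le_ofReal ?_
        exact (norm_inactiveVar_perturb_le hW hV hε _).trans (le_abs_self _)
    _ = ENNReal.ofReal (∫ x, (ε * α x + β x) ^ 2 ∂dens ρ) := by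
        rw [← ofReal_integral_sq hsq]
        simp
    _ ≤ _ := by
        refine ENNReal.ofReal_le_ofReal ?_
        have h1 : ∀ x, (ε * α x + β x) ^ 2 = ε ^ 2 * α x ^ 2 + (2 * ε * (α x * β x) + β x ^ 2) :=
          fun x => by ring
        have hi : Integrable (fun x => α x * β x) (dens ρ) := hα.integrable_mul hβ
        simp_rw [h1]
        have hi2 : Integrable (fun x => 2 * ε * (α x * β x) + β x ^ 2) (dens ρ) :=
          (hi.const_mul (2 * ε)).add hβ.integrable_sq
        rw [integral_add (hα.integrable_sq.const_mul _) hi2,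
          integral_add (hi.const_mul (2 * ε)) hβ.integrable_sq, integral_const_mul,
          integral_const_mul, hAI, hBI]
        have h2 := mul_le_mul_of_nonneg_left hcs (by positivity : 0 ≤ 2 * ε)
        nlinarith [Real.sq_sqrt ha, Real.sq_sqrt hb]

end Perturbation

/-! ### The Hellinger distance of posteriors -/

section Hellinger

lemma sq_exp_neg_half_sub_le {a b : ℝ} (ha : 0 ≤ a) (hb : 0 ≤ b) :
    (Real.exp (-a / 2) - Real.exp (-b / 2)) ^ 2 ≤ (a - b) ^ 2 / 4 := by
  have key : ∀ s t : ℝ, 0 ≤ s → s ≤ t →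
      0 ≤ Real.exp (-s / 2) - Real.exp (-t / 2) ∧
        Real.exp (-s / 2) - Real.exp (-t / 2) ≤ (t - s) / 2 := by
    intro s t hs hst
    have h1 : Real.exp (-t / 2) ≤ Real.exp (-s / 2) := Real.exp_le_exp.2 (by linarith)
    have h2 : Real.exp (-t / 2) = Real.exp (-s / 2) * Real.exp (-(t - s) / 2) := by
      rw [← Real.exp_add]; congr 1; ring
    have h3 := Real.add_one_le_exp (-(t - s) / 2)
    have h4 : Real.exp (-s / 2) ≤ 1 := Real.exp_le_one_iff.2 (by linarith)
    refine ⟨by linarith, ?_⟩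
    calc Real.exp (-s / 2) - Real.exp (-t / 2)
        = Real.exp (-s / 2) * (1 - Real.exp (-(t - s) / 2)) := by rw [h2]; ring
      _ ≤ Real.exp (-s / 2) * ((t - s) / 2) := by gcongr; linarith
      _ ≤ 1 * ((t - s) / 2) := by gcongr
      _ = _ := one_mul _
  rcases le_total a b with h | h
  · obtain ⟨h1, h2⟩ := key a b ha h
    nlinarith
  · obtain ⟨h1, h2⟩ := key b a hb h
    nlinarith

variable {n : ℕ} {ρ f h : E n → ℝ}

lemma evidence_eq (hρ : IsPrior ρ) (h : E n → ℝ) :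
    evidence ρ h = ∫ x, Real.exp (-h x) ∂dens ρ :=
  (integral_dens hρ.measurable hρ.nonneg _).symm

lemma integrable_exp_neg (hρ : IsPrior ρ) (hm : AEStronglyMeasurable h (dens ρ))
    (h0 : ∀ x, 0 ≤ h x) : Integrable (fun x => Real.exp (-h x)) (dens ρ) := by
  have := hρ.isProbabilityMeasure
  refine Integrable.of_bound (Real.continuous_exp.comp_aestronglyMeasurable hm.neg) 1
    (ae_of_all _ fun x => ?_)
  rw [Real.norm_eq_abs, Real.abs_exp]
  exact Real.exp_le_one_iff.2 (neg_nonpos.2 (h0 x))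

/-- Jensen's inequality for the exponential. -/
lemma exp_neg_integral_le_evidence (hρ : IsPrior ρ) (hi : Integrable h (dens ρ))
    (h0 : ∀ x, 0 ≤ h x) : Real.exp (-∫ x, h x ∂dens ρ) ≤ evidence ρ h := by
  have := hρ.isProbabilityMeasure
  rw [evidence_eq hρ, ← integral_neg]
  exact convexOn_exp.map_integral_le Real.continuous_exp.continuousOn isClosed_univ
    (ae_of_all _ fun _ => Set.mem_univ _) hi.neg (integrable_exp_neg hρ hi.1 h0)

lemma hellinger_sq_eq (hρ : IsPrior ρ) (f h : E n → ℝ) :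
    1 / 2 * ∫ x, (Real.sqrt (posterior ρ f x) - Real.sqrt (posterior ρ h x)) ^ 2 =
      1 / 2 * ∫ x, (Real.exp (-f x / 2) / Real.sqrt (evidence ρ f) -
        Real.exp (-h x / 2) / Real.sqrt (evidence ρ h)) ^ 2 ∂dens ρ := by
  rw [integral_dens hρ.measurable hρ.nonneg]
  congr 2
  ext x
  have hs : ∀ g : E n → ℝ, Real.sqrt (posterior ρ g x) =
      Real.exp (-g x / 2) / Real.sqrt (evidence ρ g) * Real.sqrt (ρ x) := by
    intro g
    unfold posterior
    rw [Real.sqrt_div (mul_nonneg (Real.exp_nonneg _) (hρ.nonneg x)),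
      Real.sqrt_mul (Real.exp_nonneg _), ← Real.exp_half]
    ring
  rw [hs, hs, ← sub_mul, mul_pow, Real.sq_sqrt (hρ.nonneg x)]

lemma hellinger_posterior_le (hρ : IsPrior ρ) (hf : MemLp f 2 (dens ρ)) (hh : MemLp h 2 (dens ρ))
    (hf0 : ∀ x, 0 ≤ f x) (hh0 : ∀ x, 0 ≤ h x)
    (hmean : ∫ x, h x ∂dens ρ = ∫ x, f x ∂dens ρ) :
    0 < constL ρ f ∧ hellinger (posterior ρ f) (posterior ρ h) ≤
      constL ρ f * Real.sqrt (∫ x, (f x - h x) ^ 2 ∂dens ρ) := by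
  have hprob := hρ.isProbabilityMeasure
  have hfi := hf.integrable (by norm_num : (1 : ℝ≥0∞) ≤ 2)
  have hhi := hh.integrable (by norm_num : (1 : ℝ≥0∞) ≤ 2)
  have hZf : 0 < evidence ρ f :=
    (Real.exp_pos _).trans_le (exp_neg_integral_le_evidence hρ hfi hf0)
  have hZh' := exp_neg_integral_le_evidence hρ hhi hh0
  rw [hmean] at hZh'
  have hZh : 0 < evidence ρ h := (Real.exp_pos _).trans_le hZh'
  set J := ∫ x, f x ∂dens ρ
  have hJ : ∫ x, f x * ρ x = J := (integral_dens hρ.measurable hρ.nonneg _).symm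
  have hq : 0 < evidence ρ f * Real.exp (-J) := by positivity
  have hL : constL ρ f ^ 2 = 1 / 8 * (Real.sqrt (evidence ρ f * Real.exp (-J)))⁻¹ := by
    unfold constL
    rw [hJ, Real.sq_sqrt (by positivity), Real.rpow_neg hq.le, ← Real.sqrt_eq_rpow]
  have hLpos : 0 < constL ρ f := by
    unfold constL
    rw [hJ]
    positivity
  refine ⟨hLpos, ?_⟩
  set a := Real.sqrt (evidence ρ f) with ha
  set b := Real.sqrt (evidence ρ h) with hb
  have ha0 : 0 < a := Real.sqrt_pos.2 hZf
  have hb0 : 0 < b := Real.sqrt_pos.2 hZh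
  have he : ∀ t : ℝ, Real.exp (-t / 2) ^ 2 = Real.exp (-t) := fun t => by
    rw [sq, ← Real.exp_add]; ring_nf
  have hfe := integrable_exp_neg hρ hf.1 hf0
  have hhe := integrable_exp_neg hρ hh.1 hh0
  have hfh : Integrable (fun x => Real.exp (-f x / 2) * Real.exp (-h x / 2)) (dens ρ) := by
    have := integrable_exp_neg hρ (h := fun x => (f x + h x) / 2)
      ((hfi.add hhi).div_const 2).1 (fun x => by linarith [hf0 x, hh0 x])
    refine this.congr (ae_of_all _ fun x => ?_)
    simp only
    rw [← Real.exp_add]; congr 1; ring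
  set I := ∫ x, Real.exp (-f x / 2) * Real.exp (-h x / 2) ∂dens ρ
  -- Used twice: `s = t = 1` compares the unnormalized square roots, and `s = 1/a`, `t = 1/b` gives
  -- the Hellinger distance.
  have hquad : ∀ s t : ℝ,
      ∫ x, (Real.exp (-f x / 2) * s - Real.exp (-h x / 2) * t) ^ 2 ∂dens ρ =
        s ^ 2 * a ^ 2 + t ^ 2 * b ^ 2 - 2 * s * t * I := by
    intro s t
    have h1 : ∀ x, (Real.exp (-f x / 2) * s - Real.exp (-h x / 2) * t) ^ 2 =
        (s ^ 2 * Real.exp (-f x) + t ^ 2 * Real.exp (-h x)) -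
          2 * s * t * (Real.exp (-f x / 2) * Real.exp (-h x / 2)) := by
      intro x
      rw [← he (f x), ← he (h x)]
      ring
    have h2 : Integrable (fun x => s ^ 2 * Real.exp (-f x) + t ^ 2 * Real.exp (-h x)) (dens ρ) :=
      (hfe.const_mul _).add (hhe.const_mul _)
    simp_rw [h1]
    rw [integral_sub h2 (hfh.const_mul _), integral_add (hfe.const_mul _) (hhe.const_mul _),
      integral_const_mul, integral_const_mul, integral_const_mul, ← evidence_eq hρ,
      ← evidence_eq hρ, ha, hb, Real.sq_sqrt hZf.le, Real.sq_sqrt hZh.le]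
  have hD : a ^ 2 + b ^ 2 - 2 * I ≤ (∫ x, (f x - h x) ^ 2 ∂dens ρ) / 4 := by
    have h1 := hquad 1 1
    simp only [mul_one, one_pow, one_mul] at h1
    rw [← h1, ← integral_div]
    refine integral_mono_of_nonneg (ae_of_all _ fun x => sq_nonneg _)
      ((hf.sub hh).integrable_sq.div_const 4) (ae_of_all _ fun x => ?_)
    exact sq_exp_neg_half_sub_le (hf0 x) (hh0 x)
  -- The equality of means enters here, through Jensen's bound on the evidence of `h`.
  have hab : Real.sqrt (evidence ρ f * Real.exp (-J)) ≤ a * b := by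
    rw [ha, hb, ← Real.sqrt_mul hZf.le]
    exact Real.sqrt_le_sqrt (by gcongr)
  have hdist : 1 / 2 * ∫ x, (Real.sqrt (posterior ρ f x) - Real.sqrt (posterior ρ h x)) ^ 2 ≤
      (constL ρ f * Real.sqrt (∫ x, (f x - h x) ^ 2 ∂dens ρ)) ^ 2 := by
    have hS : 0 ≤ ∫ x, (f x - h x) ^ 2 ∂dens ρ := integral_nonneg fun x => sq_nonneg _
    rw [hellinger_sq_eq hρ, mul_pow, Real.sq_sqrt hS, hL]
    simp only [div_eq_mul_inv _ (Real.sqrt _)]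
    rw [hquad]
    calc 1 / 2 * (a⁻¹ ^ 2 * a ^ 2 + b⁻¹ ^ 2 * b ^ 2 - 2 * a⁻¹ * b⁻¹ * I)
        = (2 * (a * b) - 2 * I) / (2 * (a * b)) := by field_simp; ring
      _ ≤ ((∫ x, (f x - h x) ^ 2 ∂dens ρ) / 4) / (2 * (a * b)) := by
          gcongr
          -- `2ab ≤ a² + b²` absorbs the difference of the normalizing constants without a separate
          -- estimate.
          nlinarith [sq_nonneg (a - b)]
      _ = 1 / 8 * (a * b)⁻¹ * ∫ x, (f x - h x) ^ 2 ∂dens ρ := by field_simp; ring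
      _ ≤ _ := by gcongr
  exact Real.sqrt_le_iff.2 ⟨by positivity, hdist⟩

end Hellinger

lemma condMean_nonneg {k m : ℕ} {ρ f : E (k + m) → ℝ} (hρ : IsPrior ρ) (hf : ∀ x, 0 ≤ f x)
    (V : Matrix (Fin (k + m)) (Fin (k + m)) ℝ) (y : E k) : 0 ≤ condMean ρ f V y :=
  integral_nonneg fun _ => mul_nonneg (hf _)
    (div_nonneg (hρ.nonneg _) (integral_nonneg fun _ => hρ.nonneg _))

lemma dataMisfit_nonneg {n q : ℕ} {Γ : Matrix (Fin q) (Fin q) ℝ} (hΓ : Γ.PosDef) (d : E q)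
    (G : E n → E q) (x : E n) : 0 ≤ dataMisfit Γ d G x := by
  unfold dataMisfit
  have h := hΓ.inv.posSemidef.dotProduct_mulVec_nonneg (d - G x).ofLp
  rw [star_trivial] at h
  positivity

/-- The error bound for the posterior of the perturbed conditional mean approximation of a
nonnegative function. -/
theorem hellinger_ridgeApprox_le {k m : ℕ} (hm : 1 ≤ m) {ρ f : E (k + m) → ℝ} (hρ : IsPrior ρ)
    (hf0 : ∀ x, 0 ≤ f x) (hf : DifferentiableOn ℝ f (support ρ))
    (hgi : Integrable fun x => ‖∇ f x‖ ^ 2 * ρ x)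
    {W V : Matrix (Fin (k + m)) (Fin (k + m)) ℝ} {lam : Fin (k + m) → ℝ}
    (hW : W ∈ Matrix.orthogonalGroup (Fin (k + m)) ℝ)
    (hM : gradOuter ρ f = W * Matrix.diagonal lam * W.transpose)
    (hV : V ∈ Matrix.orthogonalGroup (Fin (k + m)) ℝ) {ε : ℝ} (hε0 : 0 ≤ ε)
    (hε : ‖Matrix.toEuclideanCLM (𝕜 := ℝ) (W - V)‖ ≤ ε) :
    Integrable (fun x => f x * ρ x) ∧ 0 < constL ρ f ∧
      hellinger (posterior ρ f) (posterior ρ (ridgeApprox ρ f V)) ≤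
        Real.sqrt (condPoincareConst (k := k) (m := m) ρ).toReal * constL ρ f *
          (ε * Real.sqrt (∑ i : Fin k, lam (Fin.castAdd m i)) +
            Real.sqrt (∑ j : Fin m, lam (Fin.natAdd k j))) := by
  have hprob := hρ.isProbabilityMeasure
  have hgm := measurable_gradient f
  have hg : MemLp (fun x => ∇ f x) 2 (dens ρ) := by
    rw [memLp_two_iff_integrable_sq_norm hgm.aestronglyMeasurable,
      integrable_dens hρ.measurable hρ.nonneg]
    exact hgi
  obtain ⟨K, hK⟩ := hρ.exists_doublePoincare
  have hf2 : MemLp f 2 (dens ρ) := hK.memLp hρ hf ((memLp_two_iff hg.1).1 hg)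
  have hCpos := hρ.condPoincareConst_pos (k := k) hm
  have hCtop := hρ.condPoincareConst_lt_top (k := k) (m := m)
  have hCle : ∀ y ∈ activeDomain ρ V,
      poincareConst (condDensity ρ V y) ≤ condPoincareConst (k := k) (m := m) ρ := fun y hy =>
    le_iSup₂_of_le (f := fun V (_ : V ∈ Matrix.orthogonalGroup (Fin (k + m)) ℝ) =>
      ⨆ y ∈ activeDomain ρ V, poincareConst (condDensity ρ V y)) V hV
      (le_iSup₂_of_le (f := fun y (_ : y ∈ activeDomain ρ V) =>
        poincareConst (condDensity ρ V y)) y hy le_rfl)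
  lift condPoincareConst (k := k) (m := m) ρ to ℝ≥0 using hCtop.ne with C
  have hC0 : 0 < C := by exact_mod_cast hCpos
  set B := ε * Real.sqrt (∑ i : Fin k, lam (Fin.castAdd m i)) +
            Real.sqrt (∑ j : Fin m, lam (Fin.natAdd k j)) with hB
  have hB0 : 0 ≤ B := by positivity
  have herr : ∫⁻ x, ‖f x - ridgeApprox ρ f V x‖ₑ ^ 2 ∂dens ρ ≤ ENNReal.ofReal (C * B ^ 2) := by
    refine (lintegral_ridgeApprox_error_le hρ hV hf hC0 fun y hy =>
      PoincareIneq.of_poincareConst_le (hρ.condDensity hV hy).nonneg (hCle y hy)).trans ?_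
    rw [ENNReal.ofReal_mul C.coe_nonneg, ENNReal.ofReal_coe_nnreal]
    gcongr
    exact lintegral_inactiveVar_perturb_le hρ hg hW hM hV hε0 hε
  set h := ridgeApprox ρ f V with hh
  have hhm : AEStronglyMeasurable h (dens ρ) :=
    (measurable_ridgeApprox hρ hf V).aestronglyMeasurable
  have hd2 : MemLp (fun x => f x - h x) 2 (dens ρ) :=
    (memLp_two_iff (hf2.1.sub hhm)).2 (herr.trans_lt ENNReal.ofReal_lt_top)
  -- Square integrability of `h` follows from that of `f` and of the error `f - h`.
  have hh2 : MemLp h 2 (dens ρ) := by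
    refine (hf2.sub hd2).ae_eq (ae_of_all _ fun x => ?_)
    simp
  have hfi := hf2.integrable (by norm_num : (1 : ℝ≥0∞) ≤ 2)
  have hhi := hh2.integrable (by norm_num : (1 : ℝ≥0∞) ≤ 2)
  obtain ⟨hL, hH⟩ := hellinger_posterior_le hρ hf2 hh2 hf0
    (fun x => condMean_nonneg hρ hf0 V _) (integral_ridgeApprox hρ hV hfi hhi)
  refine ⟨(integrable_dens hρ.measurable hρ.nonneg f).1 hfi, hL, hH.trans ?_⟩
  have hS : ∫ x, (f x - h x) ^ 2 ∂dens ρ ≤ C * B ^ 2 := by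
    rw [← ENNReal.ofReal_le_ofReal_iff (by positivity)]
    have := ofReal_integral_sq hd2
    simp only [Real.norm_eq_abs, sq_abs] at this
    rwa [this]
  calc constL ρ f * Real.sqrt (∫ x, (f x - h x) ^ 2 ∂dens ρ)
      ≤ constL ρ f * Real.sqrt (C * B ^ 2) := by gcongr
    _ = Real.sqrt (C : ℝ≥0∞).toReal * constL ρ f * B := by
        rw [Real.sqrt_mul C.coe_nonneg, Real.sqrt_sq hB0, ENNReal.coe_toReal]
        ring

end ActiveSubspace

end

theorem mainTheorem8
    {k m q : ℕ} (hk : 1 ≤ k) (hm : 1 ≤ m)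
    -- the prior density: uniform on a bounded convex open set, or standard normal
    (ρ : ActiveSubspace.E (k + m) → ℝ)
    (hρ : ActiveSubspace.IsUniformConvex ρ ∨ ActiveSubspace.IsStdNormal ρ) :
    -- the Poincaré constant `C` is positive and finite
    0 < ActiveSubspace.condPoincareConst (k := k) (m := m) ρ ∧
    ActiveSubspace.condPoincareConst (k := k) (m := m) ρ < ⊤ ∧
    -- forward model `G`, data `d`, noise covariance `Γ`, data misfit `f`
    ∀ (Γ : Matrix (Fin q) (Fin q) ℝ) (_ : Γ.PosDef) (d : ActiveSubspace.E q)
      (G : ActiveSubspace.E (k + m) → ActiveSubspace.E q)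
      (f : ActiveSubspace.E (k + m) → ℝ) (_ : f = ActiveSubspace.dataMisfit Γ d G)
      (_ : DifferentiableOn ℝ f (ActiveSubspace.support ρ))
      (_ : Integrable (fun x => ‖gradient f x‖ ^ 2 * ρ x))
      -- eigendecomposition with descending eigenvalues
      (W : Matrix (Fin (k + m)) (Fin (k + m)) ℝ) (lam : Fin (k + m) → ℝ)
      (_ : W ∈ Matrix.orthogonalGroup (Fin (k + m)) ℝ) (_ : Antitone lam)
      (_ : ActiveSubspace.gradOuter ρ f = W * Matrix.diagonal lam * W.transpose)
      -- perturbed orthogonal matrix, within `ε` in the spectral norm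
      (W' : Matrix (Fin (k + m)) (Fin (k + m)) ℝ)
      (_ : W' ∈ Matrix.orthogonalGroup (Fin (k + m)) ℝ)
      (ε : ℝ) (_ : 0 < ε) (_ : ‖Matrix.toEuclideanCLM (𝕜 := ℝ) (W - W')‖ ≤ ε),
      Integrable (fun x => f x * ρ x) ∧
      0 < ActiveSubspace.constL ρ f ∧
      ActiveSubspace.hellinger (ActiveSubspace.posterior ρ f)
          (ActiveSubspace.posterior ρ (ActiveSubspace.ridgeApprox ρ f W')) ≤
        Real.sqrt (ActiveSubspace.condPoincareConst (k := k) (m := m) ρ).toReal *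
          ActiveSubspace.constL ρ f *
          (ε * Real.sqrt (∑ i : Fin k, lam (Fin.castAdd m i)) +
            Real.sqrt (∑ j : Fin m, lam (Fin.natAdd k j))) := by
  have h : ActiveSubspace.IsPrior ρ := hρ
  refine ⟨h.condPoincareConst_pos hm, h.condPoincareConst_lt_top, ?_⟩
  rintro Γ hΓ d G f rfl hf hg W lam hW - hM W' hW' ε hε0 hε
  exact ActiveSubspace.hellinger_ridgeApprox_le hm h (ActiveSubspace.dataMisfit_nonneg hΓ d G) hf
    hg hW hM hW' hε0.le hε
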